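/- For a measurable function $\phi:[0,1]^3\to[0,1]$ let $$T(\phi)=\int_{[0,1]^3}\Big(\int_0^1\phi(x,y,z')\,dz'\Big)\Big(\int_0^1\phi(x,y',z)\,dy'\Big)\Big(\int_0^1\phi(x',y,z)\,dx'\Big)\,dx\,dy\,dz .$$ For $\alpha\in[0,1]$ let $m(\alpha)=\inf\{T(\phi) : \phi:[0,1]^3\to[0,1]\text{ measurable},\ \int_{[0,1]^3}\phi=\alpha\}$, and let $m':[0,1]\to\mathbb R$ be the largest convex function on $[0,1]$ with $m'\le m$ pointwise. Corollary. For every $\alpha\in[0,1]$ and every $\varepsilon>0$ there is an $N=N(\alpha,\varepsilon)$ such that the following holds for every finite abelian group $G$ with $|G|\ge N$ and every set $A\subseteq G\times G$ with $|A|\ge\alpha|G|^2$: there is some $r\in G$, $r\neq 0$, such that $A$ contains at least $(m'(\alpha)-\varepsilon)|G|^2$ corners $\{(x,y),(x,y+r),(x+r,y)\}$ with common difference $r$; that is, there are at least that many pairs $(x,y)\in G\times G$ with $(x,y),(x,y+r),(x+r,y)\in A$. In other words, for fixed $\alpha$, $A$ contains at least $(m'(\alpha)-o(1))|G|^2$ corners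 with a common difference $r\ne0$, where $o(1)\to0$ as $|G|\to\infty$, uniformly over $G$ and $A$. -/

import Mathlib

open MeasureTheory

/-- The functional
`T(φ) = ∫_{[0,1]³} (∫ φ(x,y,z') dz') (∫ φ(x,y',z) dy') (∫ φ(x',y,z) dx') dx dy dz`
for a function `φ : [0,1]³ → [0,1]`; `volume` on `unitInterval` is Lebesgue measure. -/
noncomputable def cornerFunctional
    (φ : unitInterval × unitInterval × unitInterval → unitInterval) : ℝ :=
  ∫ p : unitInterval × unitInterval × unitInterval,
    (∫ z' : unitInterval, (φ (p.1, p.2.1, z') : ℝ)) *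
    (∫ y' : unitInterval, (φ (p.1, y', p.2.2) : ℝ)) *
    (∫ x' : unitInterval, (φ (x', p.2.1, p.2.2) : ℝ))

/-- `m(α)`: the infimum of `T(φ)` over measurable `φ : [0,1]³ → [0,1]` with mean `α`.
It is meaningful for `α ∈ [0,1]`, where such `φ` exist. -/
noncomputable def cornerInf (α : ℝ) : ℝ :=
  sInf {t : ℝ | ∃ φ : unitInterval × unitInterval × unitInterval → unitInterval,
    Measurable φ ∧ (∫ p, (φ p : ℝ)) = α ∧ t = cornerFunctional φ}

/-- `m'(α)`: the largest convex function on `[0,1]` lying pointwise below `m`, that is, the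
pointwise supremum of all convex functions on `[0,1]` that lie below `m` there. -/
noncomputable def cornerConvexMinorant (α : ℝ) : ℝ :=
  sSup {t : ℝ | ∃ g : ℝ → ℝ, ConvexOn ℝ (Set.Icc 0 1) g ∧
    (∀ β ∈ Set.Icc (0 : ℝ) 1, g β ≤ cornerInf β) ∧ t = g α}

/-- The corners `{(x,y), (x,y+r), (x+r,y)}` with common difference `r` contained in `A`,
each recorded by its vertex `(x,y)`. -/
def cornersWithDifference {G : Type*} [AddCommGroup G] [DecidableEq G]
    (A : Finset (G × G)) (r : G) : Finset (G × G) :=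
  A.filter fun p => (p.1, p.2 + r) ∈ A ∧ (p.1 + r, p.2) ∈ A

/-!
Give every point `(x, y)` of `G × G` the third coordinate `z = -x-y`. A corner of difference `r` is
the set of points having two of their coordinates from a triple `(x, y, z)` with `x + y + z = -r`,
namely `(x, y)`, `(x, -x-z)` and `(-y-z, y)`. The proof averages the number of corners over
differences in `F - F`, where `F ⊆ G` is a set of positive density on which finitely many characters
are almost constant (`exists_bohr`). The difference `0` has weight only `1 / #F`, so a lower bound
for the average (`exists_le_cornerCount`) yields a good nonzero difference once `G` is large.

**Structure.** An energy increment argument (`exists_colouring_of_energy`) finds colourings of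
`x`, `y` and `z` with boundedly many colours such that the given function `f` on `G × G` can be
replaced by a function `Φ` of the three colours. The error is small in `L¹` up to a part that
is small in cut norm for each two of the coordinates, with an accuracy chosen after the number of
colours. Corner counts with differences in `F - F` are insensitive to the second error
because the law of a random difference in `F`, evaluated at `x + y + z`, is an average of products
of a function of `y` and a function of `x + z`
(`bohrAvg_eq_expect`, `abs_bohrAvg_triangle_le`).

**Counting.** For a function of the colours, the corner count is a combination of averages of
products of colour classes at `x`, `y`, `z`, `-y-z`, `-x-z`, `-x-y`. One application of the
Cauchy–Schwarz inequality bounds such an average by the largest Fourier coefficient of any one of its factors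
(`abs_hexagon_le_of_dft_left`, `abs_hexagon_le_of_dft_right`). By a second energy increment
(`exists_scales`) there are scales `F₀`, `F`, `F₂` such that each colour class is its density at
scale `F₀`, plus a small `L²` error, plus a function with tiny Fourier coefficients. Every class
may thus be replaced by its local density, which is nearly invariant under `F - F`. Then `-y-z`
may be replaced by `x`, and likewise for the other two, and what remains is the average over
`(x, y, z)` of the corner functional of `Φ` for the local colour densities
(`abs_cornerCount_sub_weightedT`).

**Convexity.** A finite probability space is an image of the unit interval, so each of these
functionals is at least `m` at the local mean of `Φ` (`cornerInf_weightedMean_le`). The local means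
average to `α`, exactly so after a small change of `Φ` (`exists_adjusted`), and Jensen's inequality
for a convex minorant of `m` finishes the proof (`le_cornerCount_of_fitted`).
-/

namespace PopularCorners

open Finset
open scoped BigOperators ComplexConjugate

/-! ### Fourier analysis on a finite abelian group, and Bohr sets -/

section Fourier

variable {G : Type*} [AddCommGroup G] [Fintype G]

/-- The normalised Fourier transform on a finite abelian group. The character is not conjugated;
only the absolute values of the coefficients matter. -/
noncomputable def dft (u : G → ℂ) (χ : AddChar G ℂ) : ℂ := 𝔼 x, u x * χ x

theorem conj_addChar (χ : AddChar G ℂ) (x : G) : conj (χ x) = χ (-x) :=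
  (AddChar.map_neg_eq_conj χ x).symm

theorem expect_add_right {M : Type*} [AddCommMonoid M] [Module ℚ≥0 M] (f : G → M) (a : G) :
    𝔼 x, f (x + a) = 𝔼 x, f x :=
  Fintype.expect_equiv (Equiv.addRight a) _ _ fun _ => rfl

theorem expect_sub_left {M : Type*} [AddCommMonoid M] [Module ℚ≥0 M] (f : G → M) (a : G) :
    𝔼 x, f (a - x) = 𝔼 x, f x :=
  Fintype.expect_equiv (Equiv.subLeft a) _ _ fun _ => rfl

theorem expect_neg_arg {M : Type*} [AddCommMonoid M] [Module ℚ≥0 M] (f : G → M) :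
    𝔼 x, f (-x) = 𝔼 x, f x :=
  Fintype.expect_equiv (Equiv.neg G) _ _ fun _ => rfl

theorem fourier_inversion (u : G → ℂ) (x : G) :
    ∑ χ, dft u χ * χ (-x) = u x := by
  classical
  have h : ∀ χ : AddChar G ℂ, dft u χ * χ (-x) = 𝔼 y, u y * χ (y - x) := by
    intro χ
    rw [dft, expect_mul]
    refine expect_congr rfl fun y _ => ?_
    rw [sub_eq_add_neg, AddChar.map_add_eq_mul, mul_assoc]
  simp_rw [h]
  rw [← expect_sum_comm]
  simp_rw [← mul_sum, AddChar.sum_apply_eq_ite, sub_eq_zero]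
  rw [Fintype.expect_eq_sum_div_card]
  have : (Fintype.card G : ℂ) ≠ 0 := by
    have : Nonempty G := ⟨0⟩
    exact_mod_cast Fintype.card_ne_zero
  simp [this]

theorem parseval (u : G → ℂ) : ∑ χ, ‖dft u χ‖ ^ 2 = 𝔼 x, ‖u x‖ ^ 2 := by
  have h : (∑ χ, ((‖dft u χ‖ ^ 2 : ℝ) : ℂ)) = 𝔼 x, ((‖u x‖ ^ 2 : ℝ) : ℂ) := by
    have h1 : ∀ z : ℂ, ((‖z‖ ^ 2 : ℝ) : ℂ) = z * conj z := fun z => by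
      rw [Complex.mul_conj, Complex.normSq_eq_norm_sq]
    simp_rw [h1]
    have h2 : ∀ χ : AddChar G ℂ, dft u χ * conj (dft u χ)
        = 𝔼 x, u x * conj (dft u χ * χ (-x)) := by
      intro χ
      conv_lhs => rw [dft, expect_mul]
      refine expect_congr rfl fun x _ => ?_
      rw [map_mul, conj_addChar, neg_neg, dft]; ring
    simp_rw [h2]
    rw [← expect_sum_comm]
    refine expect_congr rfl fun x _ => ?_
    rw [← mul_sum, ← map_sum, fourier_inversion]
  rw [Fintype.expect_eq_sum_div_card] at h ⊢
  exact_mod_cast h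

theorem dft_translate (u : G → ℂ) (a : G) (χ : AddChar G ℂ) :
    dft (fun x => u (x + a)) χ = dft u χ * χ (-a) := by
  rw [dft, dft, expect_mul, ← expect_add_right (fun x => u x * χ x * χ (-a)) a]
  refine expect_congr rfl fun x _ => ?_
  rw [mul_assoc, ← AddChar.map_add_eq_mul, add_neg_cancel_right]

theorem expect_norm_sq_conv (a b : G → ℂ) :
    𝔼 y, ‖𝔼 x, a x * b (y - x)‖ ^ 2 = ∑ χ, ‖dft a χ‖ ^ 2 * ‖dft b χ‖ ^ 2 := by
  rw [← parseval]
  refine sum_congr rfl fun χ _ => ?_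
  rw [← mul_pow, ← norm_mul]
  congr 2
  rw [dft]
  simp_rw [expect_mul]
  rw [expect_comm, dft, expect_mul]
  refine expect_congr rfl fun x _ => ?_
  rw [dft, mul_expect, ← expect_add_right _ x]
  refine expect_congr rfl fun y _ => ?_
  rw [add_sub_cancel_right, AddChar.map_add_eq_mul]; ring

/-- The value at `χ` of the Fourier transform of the law of `t - s`, for `s` and `t` independent
and uniform in `F`. -/
noncomputable def diffMultiplier (F : Finset G) (χ : AddChar G ℂ) : ℝ := ‖𝔼 r ∈ F, χ r‖ ^ 2

/-- The average of the translates of `u` by `t - s`, where `s` and `t` range over `F`. -/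
noncomputable def smooth (F : Finset G) (u : G → ℝ) (x : G) : ℝ :=
  𝔼 s ∈ F, 𝔼 t ∈ F, u (x + (t - s))

theorem ofReal_expect {ι : Type*} (s : Finset ι) (f : ι → ℝ) :
    ((𝔼 i ∈ s, f i : ℝ) : ℂ) = 𝔼 i ∈ s, (f i : ℂ) := by
  rw [expect_eq_sum_div_card, expect_eq_sum_div_card]; push_cast; rfl

theorem expect_expect_addChar_sub (F : Finset G) (χ : AddChar G ℂ) :
    𝔼 s ∈ F, 𝔼 t ∈ F, χ (s - t) = diffMultiplier F χ := by
  have h1 : ∀ z : ℂ, ((‖z‖ ^ 2 : ℝ) : ℂ) = z * conj z := fun z => by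
    rw [Complex.mul_conj, Complex.normSq_eq_norm_sq]
  rw [diffMultiplier, h1, expect_mul]
  refine expect_congr rfl fun s _ => ?_
  have h2 : conj (𝔼 r ∈ F, χ r) = 𝔼 r ∈ F, conj (χ r) := by
    rw [expect_eq_sum_div_card, expect_eq_sum_div_card, map_div₀, map_sum]; simp
  rw [h2, mul_expect]
  refine expect_congr rfl fun t _ => ?_
  rw [conj_addChar, sub_eq_add_neg, AddChar.map_add_eq_mul]

theorem dft_smooth (F : Finset G) (u : G → ℝ) (χ : AddChar G ℂ) :
    dft (fun x => (smooth F u x : ℂ)) χ = dft (fun x => (u x : ℂ)) χ * diffMultiplier F χ := by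
  have h : ∀ s t : G, 𝔼 x, (u (x + (t - s)) : ℂ) * χ x
      = dft (fun x => (u x : ℂ)) χ * χ (s - t) := by
    intro s t
    have := dft_translate (fun x => (u x : ℂ)) (t - s) χ
    rw [neg_sub] at this
    exact this
  rw [← expect_expect_addChar_sub, dft]
  simp_rw [smooth, ofReal_expect, expect_mul]
  rw [expect_comm, mul_expect]
  refine expect_congr rfl fun s _ => ?_
  rw [expect_comm, mul_expect]
  exact expect_congr rfl fun t _ => h s t

omit [Fintype G] in
theorem diffMultiplier_nonneg (F : Finset G) (χ : AddChar G ℂ) : 0 ≤ diffMultiplier F χ :=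
  sq_nonneg _

theorem norm_expect_le {ι : Type*} (s : Finset ι) (f : ι → ℂ) :
    ‖𝔼 i ∈ s, f i‖ ≤ 𝔼 i ∈ s, ‖f i‖ := by
  rw [expect_eq_sum_div_card, expect_eq_sum_div_card, norm_div]
  simp only [RCLike.norm_natCast]
  gcongr
  exact norm_sum_le _ _

theorem diffMultiplier_le_one (F : Finset G) (χ : AddChar G ℂ) : diffMultiplier F χ ≤ 1 := by
  rcases F.eq_empty_or_nonempty with rfl | hF
  · simp [diffMultiplier]
  have : ‖𝔼 r ∈ F, χ r‖ ≤ 1 := by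
    refine (norm_expect_le _ _).trans ?_
    simp only [AddChar.norm_apply]
    rw [expect_const hF]
  exact pow_le_one₀ (norm_nonneg _) this

theorem sum_diffMultiplier {F : Finset G} (hF : F.Nonempty) :
    ∑ χ, diffMultiplier F χ = (Fintype.card G : ℝ) / #F := by
  have h : (∑ χ, (diffMultiplier F χ : ℂ)) = (Fintype.card G : ℂ) / #F := by
    classical
    simp_rw [← expect_expect_addChar_sub]
    rw [← expect_sum_comm]
    simp_rw [← expect_sum_comm, AddChar.sum_apply_eq_ite, sub_eq_zero]
    have : ∀ s ∈ F, 𝔼 t ∈ F, (if s = t then (Fintype.card G : ℂ) else 0)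
        = (Fintype.card G : ℂ) / #F := by
      intro s hs
      rw [expect_eq_sum_div_card, sum_ite_eq, if_pos hs]
    rw [expect_congr rfl this, expect_const hF]
  apply Complex.ofReal_injective
  push_cast
  exact h

theorem dft_sub (u v : G → ℂ) (χ : AddChar G ℂ) :
    dft (fun x => u x - v x) χ = dft u χ - dft v χ := by
  simp only [dft, sub_mul, expect_sub_distrib]

theorem expect_sq_smooth_sub_smooth (F F' : Finset G) (u : G → ℝ) :
    𝔼 x, (smooth F u x - smooth F' u x) ^ 2 =
      ∑ χ, (diffMultiplier F χ - diffMultiplier F' χ) ^ 2 * ‖dft (fun x => (u x : ℂ)) χ‖ ^ 2 := by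
  have h := parseval (fun x => (smooth F u x : ℂ) - (smooth F' u x : ℂ))
  have h2 : ∀ x, ‖(smooth F u x : ℂ) - (smooth F' u x : ℂ)‖ ^ 2
      = (smooth F u x - smooth F' u x) ^ 2 := fun x => by
    rw [← Complex.ofReal_sub, Complex.norm_real, Real.norm_eq_abs, sq_abs]
  simp_rw [h2] at h
  rw [← h]
  refine sum_congr rfl fun χ _ => ?_
  rw [dft_sub, dft_smooth, dft_smooth, ← mul_sub, ← Complex.ofReal_sub, norm_mul,
    Complex.norm_real, Real.norm_eq_abs, mul_pow, sq_abs, mul_comm]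

theorem norm_dft_sub_smooth (F : Finset G) (u : G → ℝ) (χ : AddChar G ℂ) :
    ‖dft (fun x => ((u x - smooth F u x : ℝ) : ℂ)) χ‖ =
      (1 - diffMultiplier F χ) * ‖dft (fun x => (u x : ℂ)) χ‖ := by
  have h : (fun x => ((u x - smooth F u x : ℝ) : ℂ)) =
      fun x => (u x : ℂ) - (smooth F u x : ℂ) := by
    ext x; push_cast; rfl
  have h2 : (1 : ℂ) - diffMultiplier F χ = ((1 - diffMultiplier F χ : ℝ) : ℂ) := by push_cast; rfl
  rw [h, dft_sub, dft_smooth, ← mul_one_sub, h2, norm_mul, Complex.norm_real, Real.norm_eq_abs,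
    abs_of_nonneg (by linarith [diffMultiplier_le_one F χ]), mul_comm]

/-- The `L²` modulus of continuity of a function along the differences of `F`. -/
theorem expect_sq_translate_sub {F : Finset G} (hF : F.Nonempty) (g : G → ℝ) :
    𝔼 s ∈ F, 𝔼 t ∈ F, 𝔼 x, (g (x + (t - s)) - g x) ^ 2 =
      ∑ χ, (2 * (1 - diffMultiplier F χ)) * ‖dft (fun x => (g x : ℂ)) χ‖ ^ 2 := by
  have h1 : ∀ s t : G, 𝔼 x, (g (x + (t - s)) - g x) ^ 2 =
      ∑ χ : AddChar G ℂ, (2 - 2 * (χ (s - t)).re) * ‖dft (fun x => (g x : ℂ)) χ‖ ^ 2 := by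
    intro s t
    have h := parseval (fun x => (g (x + (t - s)) : ℂ) - (g x : ℂ))
    have h2 : ∀ x, ‖(g (x + (t - s)) : ℂ) - (g x : ℂ)‖ ^ 2
        = (g (x + (t - s)) - g x) ^ 2 := fun x => by
      rw [← Complex.ofReal_sub, Complex.norm_real, Real.norm_eq_abs, sq_abs]
    simp_rw [h2] at h
    rw [← h]
    refine sum_congr rfl fun χ _ => ?_
    rw [dft_sub, dft_translate (fun x => (g x : ℂ)), neg_sub, ← mul_sub_one, norm_mul, mul_pow,
      mul_comm]
    congr 1
    rw [← Complex.normSq_eq_norm_sq, Complex.normSq_sub]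
    simp only [Complex.normSq_eq_norm_sq, AddChar.norm_apply]
    simp; ring
  simp_rw [h1]
  simp_rw [expect_sum_comm]
  refine sum_congr rfl fun χ _ => ?_
  simp_rw [← expect_mul]
  congr 1
  have h3 : 𝔼 s ∈ F, 𝔼 t ∈ F, (χ (s - t)).re = diffMultiplier F χ := by
    have h := congrArg Complex.re (expect_expect_addChar_sub F χ)
    rw [Complex.ofReal_re] at h
    rw [← h]
    have hre : ∀ f : G → ℂ, (𝔼 i ∈ F, f i).re = 𝔼 i ∈ F, (f i).re := fun f => by
      rw [expect_eq_sum_div_card, expect_eq_sum_div_card, Complex.div_natCast_re, Complex.re_sum]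
    simp_rw [hre]
  simp_rw [expect_sub_distrib, ← mul_expect, expect_const hF]
  rw [h3]; ring

/-- A finite colouring of the closed unit disc by sets of small diameter. -/
theorem exists_disc_colouring (ρ : ℝ) (hρ : 0 < ρ) :
    ∃ m : ℕ, ∃ c : ℂ → Fin m, ∀ z w : ℂ, ‖z‖ ≤ 1 → ‖w‖ ≤ 1 → c z = c w → ‖z - w‖ ≤ ρ := by
  have hc : TotallyBounded (Metric.closedBall (0 : ℂ) 1) :=
    (isCompact_closedBall _ _).totallyBounded
  obtain ⟨t, ht, hcov⟩ := Metric.totallyBounded_iff.1 hc (ρ / 2) (by positivity)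
  have hcov' : ∀ z : ℂ, ∃ i : Option t, ‖z‖ ≤ 1 → ∃ y : t, i = some y ∧ ‖z - y‖ < ρ / 2 := by
    intro z
    by_cases hz : ‖z‖ ≤ 1
    · have := hcov (show z ∈ Metric.closedBall 0 1 by simpa using hz)
      simp only [Set.mem_iUnion, Metric.mem_ball, exists_prop, dist_eq_norm] at this
      obtain ⟨y, hy, hzy⟩ := this
      exact ⟨some ⟨y, hy⟩, fun _ => ⟨⟨y, hy⟩, rfl, hzy⟩⟩
    · exact ⟨none, fun h => absurd h hz⟩
  choose c hc using hcov'
  have : Fintype t := ht.fintype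
  refine ⟨Fintype.card (Option t), fun z => Fintype.equivFin _ (c z), fun z w hz hw h => ?_⟩
  have h' := (Fintype.equivFin (Option t)).injective h
  obtain ⟨y, hy, hzy⟩ := hc z hz
  obtain ⟨y', hy', hwy⟩ := hc w hw
  have : y = y' := by rw [hy, hy'] at h'; exact Option.some.inj h'
  subst this
  calc ‖z - w‖ = ‖(z - y) - (w - y)‖ := by congr 1; ring
    _ ≤ ‖z - y‖ + ‖w - y‖ := norm_sub_le _ _
    _ ≤ ρ := by linarith

end Fourier

/-- By the pigeonhole principle, a set of positive density on which every character from a given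
bounded set is almost constant. Its difference set plays the role of a Bohr set. -/
theorem exists_bohr (k : ℕ) (ρ : ℝ) (hρ : 0 < ρ) :
    ∃ C : ℝ, 0 < C ∧ ∀ (G : Type*) [AddCommGroup G] [Fintype G] (Λ : Finset (AddChar G ℂ)),
      #Λ ≤ k → ∃ F : Finset G, F.Nonempty ∧ (Fintype.card G : ℝ) ≤ C * #F ∧
        ∀ χ ∈ Λ, 1 - diffMultiplier F χ ≤ ρ := by
  classical
  obtain ⟨m, c, hc⟩ := exists_disc_colouring ρ hρ
  have hm : 1 ≤ m := Fin.pos (c 0)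
  refine ⟨(m : ℝ) ^ k, by positivity, ?_⟩
  intro G _ _ Λ hΛ
  have hcard : Fintype.card (Λ → Fin m) = m ^ #Λ := by simp
  have hmpos : (0 : ℝ) < (m : ℝ) ^ k := by positivity
  have hne : Nonempty (Λ → Fin m) := ⟨fun _ => ⟨0, hm⟩⟩
  obtain ⟨y, hy⟩ := Fintype.exists_le_card_fiber_of_nsmul_le_card
    (fun x : G => fun χ : Λ => c (χ.1 x)) (M := ℝ) (b := (Fintype.card G : ℝ) / (m : ℝ) ^ k) (by
      rw [hcard, nsmul_eq_mul]
      push_cast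
      rw [mul_div_assoc', div_le_iff₀ hmpos, mul_comm]
      gcongr
      exact_mod_cast hm)
  set F := univ.filter fun x : G => (fun χ : Λ => c (χ.1 x)) = y with hFdef
  have hN : (0 : ℝ) < Fintype.card G := by
    have : Nonempty G := ⟨0⟩
    exact_mod_cast Fintype.card_pos
  have hF : F.Nonempty := by
    rw [← card_pos]
    have : (0 : ℝ) < #F := lt_of_lt_of_le (by positivity) hy
    exact_mod_cast this
  refine ⟨F, hF, by rw [div_le_iff₀ hmpos] at hy; linarith, ?_⟩
  intro χ hχ
  have h3 : ∀ s ∈ F, ∀ t ∈ F, ‖1 - χ (s - t)‖ ≤ ρ := by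
    intro s hs t ht
    have hs' := congrFun (mem_filter.1 hs).2 ⟨χ, hχ⟩
    have ht' := congrFun (mem_filter.1 ht).2 ⟨χ, hχ⟩
    have := hc (χ t) (χ s) (AddChar.norm_apply _ _).le (AddChar.norm_apply _ _).le
      (ht'.trans hs'.symm)
    have h4 : 1 - χ (s - t) = (χ t - χ s) * χ (-t) := by
      rw [sub_mul, ← AddChar.map_add_eq_mul, ← AddChar.map_add_eq_mul, sub_eq_add_neg s]
      simp
    rwa [h4, norm_mul, AddChar.norm_apply, mul_one]
  have h5 : (1 : ℂ) - diffMultiplier F χ = 𝔼 s ∈ F, 𝔼 t ∈ F, (1 - χ (s - t)) := by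
    simp_rw [expect_sub_distrib, expect_const hF]
    rw [expect_expect_addChar_sub]
  have h6 : ‖(1 : ℂ) - diffMultiplier F χ‖ ≤ ρ := by
    rw [h5]
    refine (norm_expect_le _ _).trans ?_
    refine (expect_le_expect (g := fun _ => ρ) fun s hs => ?_).trans (expect_const hF _).le
    refine (norm_expect_le _ _).trans ?_
    exact (expect_le_expect (g := fun _ => ρ) fun t ht => h3 s hs t ht).trans
      (expect_const hF _).le
  have h7 : (1 : ℂ) - diffMultiplier F χ = ((1 - diffMultiplier F χ : ℝ) : ℂ) := by push_cast; rfl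
  rw [h7, Complex.norm_real] at h6
  exact (le_abs_self _).trans h6

/-! ### Choice of scales -/

section Scales

variable {G : Type*} [AddCommGroup G] [Fintype G]

theorem sum_sq_norm_dft_le {u : G → ℝ} (hu : ∀ x, |u x| ≤ 1) :
    ∑ χ, ‖dft (fun x => (u x : ℂ)) χ‖ ^ 2 ≤ 1 := by
  rw [parseval]
  have : Nonempty G := ⟨0⟩
  refine (expect_le_expect (g := fun _ => (1 : ℝ)) fun x _ => ?_).trans (Fintype.expect_const _).le
  rw [Complex.norm_real, Real.norm_eq_abs]
  exact pow_le_one₀ (abs_nonneg _) (hu x)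

theorem norm_dft_le_one {u : G → ℝ} (hu : ∀ x, |u x| ≤ 1) (χ : AddChar G ℂ) :
    ‖dft (fun x => (u x : ℂ)) χ‖ ≤ 1 := by
  have h := (single_le_sum (f := fun χ => ‖dft (fun x => (u x : ℂ)) χ‖ ^ 2)
    (fun _ _ => sq_nonneg _) (mem_univ χ)).trans (sum_sq_norm_dft_le hu)
  exact (sq_le_one_iff₀ (norm_nonneg _)).1 h

theorem card_filter_mul_le {ι : Type*} [Fintype ι] (f : ι → ℝ) (hf : ∀ i, 0 ≤ f i) (a : ℝ)
    [DecidablePred fun i => a ≤ f i] :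
    (#(univ.filter fun i => a ≤ f i) : ℝ) * a ≤ ∑ i, f i := by
  rw [← nsmul_eq_mul, ← sum_const]
  refine (sum_le_sum fun i hi => (mem_filter.1 hi).2).trans ?_
  exact sum_le_univ_sum_of_nonneg hf

/-- The `L²` mass of the smoothed functions, on the Fourier side. -/
noncomputable def smoothEnergy {ι : Type*} [Fintype ι] (u : ι → G → ℝ) (F : Finset G) : ℝ :=
  ∑ i, ∑ χ, diffMultiplier F χ ^ 2 * ‖dft (fun x => (u i x : ℂ)) χ‖ ^ 2

theorem smoothEnergy_le {ι : Type*} [Fintype ι] {u : ι → G → ℝ} (hu : ∀ i x, |u i x| ≤ 1)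
    (F : Finset G) : smoothEnergy u F ≤ Fintype.card ι := by
  have h : ∀ i, ∑ χ, diffMultiplier F χ ^ 2 * ‖dft (fun x => (u i x : ℂ)) χ‖ ^ 2 ≤ 1 := by
    intro i
    refine (sum_le_sum fun χ _ => ?_).trans (sum_sq_norm_dft_le (hu i))
    exact mul_le_of_le_one_left (sq_nonneg _)
      (pow_le_one₀ (diffMultiplier_nonneg _ _) (diffMultiplier_le_one _ _))
  calc smoothEnergy u F ≤ ∑ _i : ι, (1 : ℝ) := sum_le_sum fun i _ => h i
    _ = Fintype.card ι := by simp

/-- Three scales `F₀`, `F₁`, `F₂` fit a function `u`: the average of `u` at scale `F₀` is close to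
the one at the finer scale `F₂`, what is left over at scale `F₂` has small Fourier coefficients,
even relative to the density of `F₁`, and the average at scale `F₀` is nearly invariant under the
differences of `F₁`. -/
structure GoodScales (u : G → ℝ) (δ : ℝ) (F₀ F₁ F₂ : Finset G) : Prop where
  close : 𝔼 x, (smooth F₂ u x - smooth F₀ u x) ^ 2 ≤ δ
  unif : ∀ χ, ((Fintype.card G : ℝ) / #F₁) ^ 2 *
    ‖dft (fun x => ((u x - smooth F₂ u x : ℝ) : ℂ)) χ‖ ≤ δ
  shift : 𝔼 s ∈ F₁, 𝔼 t ∈ F₁, 𝔼 x, (smooth F₀ u (x + (t - s)) - smooth F₀ u x) ^ 2 ≤ δ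

theorem expect_sq_shift_smooth_le {F₀ F₁ : Finset G} (hF₁ : F₁.Nonempty) {u : G → ℝ}
    (hu : ∀ x, |u x| ≤ 1) {δ : ℝ}
    (h : ∀ χ, diffMultiplier F₀ χ * (1 - diffMultiplier F₁ χ) ≤ δ) :
    𝔼 s ∈ F₁, 𝔼 t ∈ F₁, 𝔼 x, (smooth F₀ u (x + (t - s)) - smooth F₀ u x) ^ 2 ≤ 2 * δ := by
  rw [expect_sq_translate_sub hF₁]
  have hδ : 0 ≤ δ := (mul_nonneg (diffMultiplier_nonneg _ _)
    (by linarith [diffMultiplier_le_one F₁ 0])).trans (h 0)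
  calc _ ≤ ∑ χ, 2 * δ * ‖dft (fun x => (u x : ℂ)) χ‖ ^ 2 := by
        refine sum_le_sum fun χ _ => ?_
        rw [dft_smooth, norm_mul, Complex.norm_real, Real.norm_eq_abs,
          abs_of_nonneg (diffMultiplier_nonneg _ _), mul_pow]
        have h0 := diffMultiplier_nonneg F₀ χ
        have h1 := diffMultiplier_le_one F₀ χ
        have h2 := diffMultiplier_le_one F₁ χ
        have h3 : (1 - diffMultiplier F₁ χ) * diffMultiplier F₀ χ ^ 2 ≤ δ := by
          refine le_trans ?_ (h χ)
          nlinarith [mul_nonneg (mul_nonneg h0 (sub_nonneg.2 h1)) (sub_nonneg.2 h2)]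
        nlinarith [sq_nonneg ‖dft (fun x => (u x : ℂ)) χ‖]
    _ ≤ 2 * δ * 1 := by
        rw [← mul_sum]
        exact mul_le_mul_of_nonneg_left (sum_sq_norm_dft_le hu) (by linarith)
    _ = 2 * δ := mul_one _

/-- If the smoothings at two scales are far apart, then passing to the finer scale
increases the energy. -/
theorem sum_expect_sq_le_energy_sub {ι : Type*} [Fintype ι] {u : ι → G → ℝ}
    (hu : ∀ i x, |u i x| ≤ 1) {F₀ F₂ : Finset G} {δ : ℝ}
    (h : ∀ χ, diffMultiplier F₀ χ * (1 - diffMultiplier F₂ χ) ≤ δ) :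
    ∑ i, 𝔼 x, (smooth F₂ (u i) x - smooth F₀ (u i) x) ^ 2 ≤
      smoothEnergy u F₂ - smoothEnergy u F₀ + 2 * δ * Fintype.card ι := by
  have hδ : 0 ≤ δ := (mul_nonneg (diffMultiplier_nonneg _ _)
    (by linarith [diffMultiplier_le_one F₂ 0])).trans (h 0)
  have h1 : ∀ i, 𝔼 x, (smooth F₂ (u i) x - smooth F₀ (u i) x) ^ 2 ≤
      ∑ χ, diffMultiplier F₂ χ ^ 2 * ‖dft (fun x => (u i x : ℂ)) χ‖ ^ 2 -
      ∑ χ, diffMultiplier F₀ χ ^ 2 * ‖dft (fun x => (u i x : ℂ)) χ‖ ^ 2 + 2 * δ * 1 := by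
    intro i
    rw [expect_sq_smooth_sub_smooth, ← sum_sub_distrib]
    refine le_trans ?_ (add_le_add_right (mul_le_mul_of_nonneg_left
      (sum_sq_norm_dft_le (hu i)) (by linarith : 0 ≤ 2 * δ)) _)
    rw [mul_sum, ← sum_add_distrib]
    refine sum_le_sum fun χ _ => ?_
    have h0 := diffMultiplier_nonneg F₀ χ
    have h1 := diffMultiplier_le_one F₀ χ
    have h2 := h χ
    rw [← sub_mul, ← add_mul]
    refine mul_le_mul_of_nonneg_right ?_ (sq_nonneg _)
    nlinarith
  refine (sum_le_sum fun i _ => h1 i).trans ?_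
  rw [sum_add_distrib, sum_sub_distrib]
  simp only [smoothEnergy, sum_const, card_univ, nsmul_eq_mul]
  linarith

end Scales

/-- One step of the choice of scales: a Bohr set almost invariant for a given multiplier and for
the large Fourier coefficients of given functions. -/
theorem exists_finer_scale (n : ℕ) (C₀ δ η : ℝ) (hδ : 0 < δ) (hη : 0 < η) :
    ∃ C : ℝ, 0 < C ∧ ∀ (G : Type*) [AddCommGroup G] [Fintype G] (ι : Type) [Fintype ι]
      (u : ι → G → ℝ) (F₀ : Finset G), Fintype.card ι ≤ n → (∀ i x, |u i x| ≤ 1) →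
      F₀.Nonempty → (Fintype.card G : ℝ) ≤ C₀ * #F₀ →
      ∃ F : Finset G, F.Nonempty ∧ (Fintype.card G : ℝ) ≤ C * #F ∧
        (∀ χ, diffMultiplier F₀ χ * (1 - diffMultiplier F χ) ≤ δ) ∧
        ∀ i χ, ‖dft (fun x => ((u i x - smooth F (u i) x : ℝ) : ℂ)) χ‖ ≤ η := by
  classical
  obtain ⟨C, hC, hB⟩ := exists_bohr (⌊C₀ / δ⌋₊ + ⌊n / η ^ 2⌋₊) (min δ η) (lt_min hδ hη)
  refine ⟨C, hC, ?_⟩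
  intro G _ _ ι _ u F₀ hn hu hF₀ hG
  -- Both spectra have bounded size, as the multiplier is summable and the coefficients are
  -- square-summable. Off `A` the multiplier of `F₀` is small, off `B` the coefficients are.
  let A : Finset (AddChar G ℂ) := univ.filter fun χ => δ ≤ diffMultiplier F₀ χ
  let B : Finset (AddChar G ℂ) := univ.filter fun χ =>
    η ^ 2 ≤ ∑ i, ‖dft (fun x => (u i x : ℂ)) χ‖ ^ 2
  have hA : #A ≤ ⌊C₀ / δ⌋₊ := by
    refine Nat.le_floor ?_
    rw [le_div_iff₀ hδ]
    refine (card_filter_mul_le _ (diffMultiplier_nonneg F₀) δ).trans ?_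
    rw [sum_diffMultiplier hF₀, div_le_iff₀ (by exact_mod_cast hF₀.card_pos)]
    exact hG
  have hB' : #B ≤ ⌊n / η ^ 2⌋₊ := by
    refine Nat.le_floor ?_
    rw [le_div_iff₀ (by positivity)]
    refine (card_filter_mul_le _ (fun χ => sum_nonneg fun i _ => sq_nonneg _) (η ^ 2)).trans ?_
    rw [sum_comm]
    refine (sum_le_sum fun i _ => sum_sq_norm_dft_le (hu i)).trans ?_
    simpa using hn
  obtain ⟨F, hF, hGF, hρ⟩ := hB G (A ∪ B) ((card_union_le _ _).trans (add_le_add hA hB'))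
  refine ⟨F, hF, hGF, fun χ => ?_, fun i χ => ?_⟩
  · have h0 := diffMultiplier_nonneg F₀ χ
    have h1 := diffMultiplier_le_one F₀ χ
    have h2 := diffMultiplier_nonneg F χ
    have h3 := diffMultiplier_le_one F χ
    by_cases hχ : δ ≤ diffMultiplier F₀ χ
    · have := (hρ χ (mem_union_left _ (mem_filter.2 ⟨mem_univ _, hχ⟩))).trans (min_le_left _ _)
      nlinarith
    · push Not at hχ
      nlinarith
  · rw [norm_dft_sub_smooth]
    have h0 := norm_nonneg (dft (fun x => (u i x : ℂ)) χ)
    have h1 := norm_dft_le_one (hu i) χ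
    have h2 := diffMultiplier_nonneg F χ
    have h3 := diffMultiplier_le_one F χ
    by_cases hχ : η ≤ ‖dft (fun x => (u i x : ℂ)) χ‖
    · have hmem : χ ∈ B := by
        refine mem_filter.2 ⟨mem_univ _, (pow_le_pow_left₀ hη.le hχ 2).trans ?_⟩
        exact single_le_sum (f := fun i => ‖dft (fun x => (u i x : ℂ)) χ‖ ^ 2)
          (fun _ _ => sq_nonneg _) (mem_univ i)
      have := (hρ χ (mem_union_right _ hmem)).trans (min_le_right _ _)
      nlinarith
    · push Not at hχ
      nlinarith

/-- Either two further scales complete `F` to a good triple, or the finer of them has more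
energy than `F`. -/
theorem goodScales_or_energy_increment (n : ℕ) (δ : ℝ) (hδ : 0 < δ) (C₀ : ℝ) :
    ∃ C₁ C₂ : ℝ, 0 < C₁ ∧ 0 < C₂ ∧ ∀ (G : Type*) [AddCommGroup G] [Fintype G] (ι : Type)
      [Fintype ι] (u : ι → G → ℝ) (F : Finset G), Fintype.card ι ≤ n → (∀ i x, |u i x| ≤ 1) →
      F.Nonempty → (Fintype.card G : ℝ) ≤ C₀ * #F →
      ∃ F₁ F₂ : Finset G, F₁.Nonempty ∧ F₂.Nonempty ∧ (Fintype.card G : ℝ) ≤ C₁ * #F₁ ∧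
        (Fintype.card G : ℝ) ≤ C₂ * #F₂ ∧
        ((∀ i, GoodScales (u i) δ F F₁ F₂) ∨ smoothEnergy u F + δ / 2 ≤ smoothEnergy u F₂) := by
  have hn : (0 : ℝ) < 4 * (n + 1) := by positivity
  -- The tolerance for the multipliers: summed over the functions, its contribution to the
  -- energy comparison stays below `δ / 2`.
  obtain ⟨δ', hδ'⟩ : ∃ δ' : ℝ, δ' = δ / (4 * (n + 1)) := ⟨_, rfl⟩
  have hδ'0 : 0 < δ' := by rw [hδ']; positivity
  have hδ'n : δ' * (4 * (n + 1)) = δ := by rw [hδ', div_mul_cancel₀ _ hn.ne']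
  obtain ⟨C₁, hC₁, h₁⟩ := exists_finer_scale n C₀ δ' 1 hδ'0 one_pos
  -- The finest scale is chosen last: its uniformity has to beat the density of `F₁`.
  obtain ⟨C₂, hC₂, h₂⟩ := exists_finer_scale n C₀ δ' (δ / C₁ ^ 2) hδ'0 (by positivity)
  refine ⟨C₁, C₂, hC₁, hC₂, fun G _ _ ι _ u F hι hu hF hG => ?_⟩
  obtain ⟨F₁, hF₁, hG₁, hm₁, -⟩ := h₁ G ι u F hι hu hF hG
  obtain ⟨F₂, hF₂, hG₂, hm₂, hη⟩ := h₂ G ι u F hι hu hF hG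
  refine ⟨F₁, F₂, hF₁, hF₂, hG₁, hG₂, ?_⟩
  by_contra! hcon
  obtain ⟨hcon, hE⟩ := hcon
  refine absurd hcon (not_exists.2 fun i => not_not.2 ⟨?_, fun χ => ?_, ?_⟩)
  · have hle := single_le_sum
      (f := fun i => 𝔼 x, (smooth F₂ (u i) x - smooth F (u i) x) ^ 2)
      (fun _ _ => expect_nonneg fun _ _ => sq_nonneg _) (mem_univ i)
    refine (hle.trans (sum_expect_sq_le_energy_sub hu hm₂)).trans ?_
    have : 2 * δ' * Fintype.card ι ≤ 2 * δ' * n := by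
      have : (Fintype.card ι : ℝ) ≤ n := by exact_mod_cast hι
      gcongr
    nlinarith
  · have hF₁' : (0 : ℝ) < #F₁ := by exact_mod_cast hF₁.card_pos
    calc ((Fintype.card G : ℝ) / #F₁) ^ 2 *
          ‖dft (fun x => ((u i x - smooth F₂ (u i) x : ℝ) : ℂ)) χ‖
        ≤ C₁ ^ 2 * (δ / C₁ ^ 2) := by
          gcongr
          · rwa [div_le_iff₀ hF₁']
          · exact hη i χ
      _ = δ := by field_simp
  · refine (expect_sq_shift_smooth_le hF₁ (hu i) hm₁).trans ?_
    nlinarith [(Nat.cast_nonneg n : (0 : ℝ) ≤ n)]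

/-- The energy is at most `n`, so at most `2 * n / δ` increments are possible; `k` counts the
increments left. -/
theorem exists_scales_of_energy (n : ℕ) (δ : ℝ) (hδ : 0 < δ) (k : ℕ) :
    ∀ C₀ : ℝ, ∃ C : ℝ, 0 < C ∧ ∀ (G : Type*) [AddCommGroup G] [Fintype G] (ι : Type)
      [Fintype ι] (u : ι → G → ℝ) (F : Finset G), Fintype.card ι ≤ n → (∀ i x, |u i x| ≤ 1) →
      F.Nonempty → (Fintype.card G : ℝ) ≤ C₀ * #F →
      (n : ℝ) ≤ smoothEnergy u F + k * (δ / 2) →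
      ∃ F₀ F₁ F₂ : Finset G, F₀.Nonempty ∧ F₁.Nonempty ∧ F₂.Nonempty ∧
        (Fintype.card G : ℝ) ≤ C * #F₁ ∧ ∀ i, GoodScales (u i) δ F₀ F₁ F₂ := by
  induction k with
  | zero =>
    intro C₀
    obtain ⟨C₁, C₂, hC₁, hC₂, h⟩ := goodScales_or_energy_increment n δ hδ C₀
    refine ⟨C₁, hC₁, fun G _ _ ι _ u F hι hu hF hG hE => ?_⟩
    obtain ⟨F₁, F₂, hF₁, hF₂, hG₁, hG₂, hgood | hinc⟩ := h G ι u F hι hu hF hG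
    · exact ⟨F, F₁, F₂, hF, hF₁, hF₂, hG₁, hgood⟩
    · have h1 := smoothEnergy_le hu F₂
      have h2 : (Fintype.card ι : ℝ) ≤ n := by exact_mod_cast hι
      push_cast at hE
      linarith
  | succ k ih =>
    intro C₀
    obtain ⟨C₁, C₂, hC₁, hC₂, h⟩ := goodScales_or_energy_increment n δ hδ C₀
    obtain ⟨C, hC, h'⟩ := ih C₂
    refine ⟨max C₁ C, lt_max_of_lt_left hC₁, fun G _ _ ι _ u F hι hu hF hG hE => ?_⟩
    obtain ⟨F₁, F₂, hF₁, hF₂, hG₁, hG₂, hgood | hinc⟩ := h G ι u F hι hu hF hG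
    · exact ⟨F, F₁, F₂, hF, hF₁, hF₂, hG₁.trans (by gcongr; exact le_max_left _ _), hgood⟩
    · push_cast at hE
      obtain ⟨F₀', F₁', F₂', h0, h1, h2, h3, h4⟩ := h' G ι u F₂ hι hu hF₂ hG₂ (by linarith)
      exact ⟨F₀', F₁', F₂', h0, h1, h2, h3.trans (by gcongr; exact le_max_right _ _), h4⟩

/-- Scales at which all of the functions `u i` are well behaved, the middle one of density
bounded below independently of the group. -/
theorem exists_scales (n : ℕ) (δ : ℝ) (hδ : 0 < δ) :
    ∃ C : ℝ, 0 < C ∧ ∀ (G : Type*) [AddCommGroup G] [Fintype G] (ι : Type) [Fintype ι]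
      (u : ι → G → ℝ), Fintype.card ι ≤ n → (∀ i x, |u i x| ≤ 1) →
      ∃ F₀ F₁ F₂ : Finset G, F₀.Nonempty ∧ F₁.Nonempty ∧ F₂.Nonempty ∧
        (Fintype.card G : ℝ) ≤ C * #F₁ ∧ ∀ i, GoodScales (u i) δ F₀ F₁ F₂ := by
  obtain ⟨k, hk⟩ := exists_nat_ge (n / (δ / 2))
  obtain ⟨C, hC, h⟩ := exists_scales_of_energy n δ hδ k 1
  refine ⟨C, hC, fun G _ _ ι _ u hn hu => ?_⟩
  have : Nonempty G := ⟨0⟩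
  refine h G ι u univ hn hu univ_nonempty (by simp) ?_
  rw [div_le_iff₀ (by positivity)] at hk
  have : 0 ≤ smoothEnergy u univ :=
    sum_nonneg fun i _ => sum_nonneg fun χ _ => mul_nonneg (sq_nonneg _) (sq_nonneg _)
  linarith

/-! ### Hexagonal forms and Fourier coefficients -/

section Expect

theorem sq_expect_le {ι : Type*} (s : Finset ι) (f : ι → ℝ) :
    (𝔼 i ∈ s, f i) ^ 2 ≤ 𝔼 i ∈ s, f i ^ 2 := by
  rcases s.eq_empty_or_nonempty with rfl | hs
  · simp
  have h : (0 : ℝ) < #s := by exact_mod_cast hs.card_pos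
  rw [expect_eq_sum_div_card, expect_eq_sum_div_card, div_pow, div_le_div_iff₀ (by positivity) h]
  nlinarith [sq_sum_le_card_mul_sum_sq (s := s) (f := f)]

theorem abs_expect_le' {ι : Type*} (s : Finset ι) (f : ι → ℝ) :
    |𝔼 i ∈ s, f i| ≤ 𝔼 i ∈ s, |f i| := by
  rw [expect_eq_sum_div_card, expect_eq_sum_div_card, abs_div, Nat.abs_cast]
  gcongr
  exact abs_sum_le_sum_abs _ _

theorem expect_le_of_forall_le {ι : Type*} {s : Finset ι} (hs : s.Nonempty) {f : ι → ℝ} {b : ℝ}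
    (h : ∀ i ∈ s, f i ≤ b) : 𝔼 i ∈ s, f i ≤ b :=
  (expect_le_expect (g := fun _ => b) h).trans (expect_const hs b).le

theorem abs_expect_le_of_forall {ι : Type*} {s : Finset ι} (hs : s.Nonempty) {f : ι → ℝ} {b : ℝ}
    (h : ∀ i ∈ s, |f i| ≤ b) : |𝔼 i ∈ s, f i| ≤ b :=
  (abs_expect_le' s f).trans (expect_le_of_forall_le hs h)

theorem abs_expect_le_of_sq {ι : Type*} {s : Finset ι} {f : ι → ℝ} {b : ℝ} (hb : 0 ≤ b)
    (h : 𝔼 i ∈ s, f i ^ 2 ≤ b ^ 2) : 𝔼 i ∈ s, |f i| ≤ b := by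
  refine le_of_sq_le_sq ?_ hb
  refine (sq_expect_le s _).trans ?_
  simpa only [sq_abs] using h

theorem abs_mul_le_one {a b : ℝ} (ha : |a| ≤ 1) (hb : |b| ≤ 1) : |a * b| ≤ 1 := by
  rw [abs_mul]; exact mul_le_one₀ ha (abs_nonneg _) hb

end Expect

variable {G : Type*} [AddCommGroup G] [Fintype G]

section Free

theorem expect_sq_conv (u g : G → ℝ) :
    𝔼 z, (𝔼 y, u y * g (-z - y)) ^ 2 =
      ∑ χ, ‖dft (fun x => (u x : ℂ)) χ‖ ^ 2 * ‖dft (fun x => (g x : ℂ)) χ‖ ^ 2 := by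
  rw [← expect_norm_sq_conv, ← expect_neg_arg]
  refine expect_congr rfl fun z _ => ?_
  rw [neg_neg, ← sq_abs, ← Real.norm_eq_abs, ← Complex.norm_real, ofReal_expect]
  simp

/-- Bilinear forms `u(y) v(z) g(-y-z)` are controlled by the Fourier coefficients of `g`. -/
theorem abs_expect_bilinear_le {u v g : G → ℝ} (hu : ∀ x, |u x| ≤ 1) (hv : ∀ x, |v x| ≤ 1)
    {b : ℝ} (hb : 0 ≤ b) (hg : ∀ χ, ‖dft (fun x => (g x : ℂ)) χ‖ ≤ b) :
    |𝔼 y, 𝔼 z, u y * v z * g (-y - z)| ≤ b := by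
  have h : 𝔼 y, 𝔼 z, u y * v z * g (-y - z) = 𝔼 z, v z * 𝔼 y, u y * g (-z - y) := by
    rw [expect_comm]
    refine expect_congr rfl fun z _ => ?_
    rw [mul_expect]
    refine expect_congr rfl fun y _ => ?_
    rw [show -y - z = -z - y by abel]; ring
  rw [h]
  refine (abs_expect_le' _ _).trans (abs_expect_le_of_sq hb ?_)
  calc 𝔼 z, (v z * 𝔼 y, u y * g (-z - y)) ^ 2 ≤ 𝔼 z, (𝔼 y, u y * g (-z - y)) ^ 2 := by
        refine expect_le_expect fun z _ => ?_
        rw [mul_pow]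
        exact mul_le_of_le_one_left (sq_nonneg _) ((sq_le_one_iff_abs_le_one _).2 (hv z))
    _ ≤ ∑ χ, ‖dft (fun x => (u x : ℂ)) χ‖ ^ 2 * b ^ 2 := by
        rw [expect_sq_conv]
        gcongr with χ
        exact hg χ
    _ ≤ b ^ 2 := by
        rw [← sum_mul]
        exact mul_le_of_le_one_left (sq_nonneg _) (sum_sq_norm_dft_le hu)

theorem dft_mul_addChar (u : G → ℂ) (χ ψ : AddChar G ℂ) :
    dft (fun x => u x * χ x) ψ = dft u (χ + ψ) := by
  simp only [dft, AddChar.add_apply, mul_assoc]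

/-- The `L²` form of the control of the hexagonal form by the Fourier coefficients of `f`. -/
theorem expect_sq_le_of_dft_le {f g h : G → ℝ} (hg : ∀ x, |g x| ≤ 1) (hh : ∀ x, |h x| ≤ 1)
    {b : ℝ} (hf : ∀ χ, ‖dft (fun x => (f x : ℂ)) χ‖ ≤ b) :
    𝔼 z, 𝔼 y, (𝔼 x, f x * g (-z - x) * h (-y - x)) ^ 2 ≤ b ^ 2 := by
  have h1 : ∀ z, 𝔼 y, (𝔼 x, f x * g (-z - x) * h (-y - x)) ^ 2 =
      ∑ χ, ‖dft (fun x => ((f x * g (-z - x) : ℝ) : ℂ)) χ‖ ^ 2 *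
        ‖dft (fun x => (h x : ℂ)) χ‖ ^ 2 :=
    fun z => expect_sq_conv (fun x => f x * g (-z - x)) h
  have h2 : ∀ χ, 𝔼 z, ‖dft (fun x => ((f x * g (-z - x) : ℝ) : ℂ)) χ‖ ^ 2 ≤ b ^ 2 := by
    intro χ
    have h3 := expect_norm_sq_conv (fun x => (f x : ℂ) * χ x) (fun x => (g x : ℂ))
    rw [← expect_neg_arg] at h3
    have h4 : ∀ z, dft (fun x => ((f x * g (-z - x) : ℝ) : ℂ)) χ =
        𝔼 x, (f x : ℂ) * χ x * (g (-z - x) : ℂ) := by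
      intro z
      refine expect_congr rfl fun x _ => ?_
      push_cast; ring
    simp_rw [h4, h3, dft_mul_addChar]
    calc _ ≤ ∑ ψ, b ^ 2 * ‖dft (fun x => (g x : ℂ)) ψ‖ ^ 2 := by
          gcongr with ψ
          exact hf _
      _ ≤ b ^ 2 := by
          rw [← mul_sum]
          exact mul_le_of_le_one_right (sq_nonneg _) (sum_sq_norm_dft_le hg)
  simp_rw [h1]
  rw [expect_sum_comm]
  simp_rw [← expect_mul]
  calc _ ≤ ∑ χ, b ^ 2 * ‖dft (fun x => (h x : ℂ)) χ‖ ^ 2 := by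
        gcongr with χ
        exact h2 χ
    _ ≤ b ^ 2 := by
        rw [← mul_sum]
        exact mul_le_of_le_one_right (sq_nonneg _) (sum_sq_norm_dft_le hh)

/-- The hexagonal form is controlled by the Fourier coefficients of its function of `x`: after one
application of the Cauchy–Schwarz inequality the Parseval identity applies twice. -/
theorem abs_expect_hexagon_le_of_dft_le {f₁ f₂ f₃ g₁ g₂ g₃ : G → ℝ} (hf₂ : ∀ x, |f₂ x| ≤ 1)
    (hf₃ : ∀ x, |f₃ x| ≤ 1) (hg₁ : ∀ x, |g₁ x| ≤ 1) (hg₂ : ∀ x, |g₂ x| ≤ 1)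
    (hg₃ : ∀ x, |g₃ x| ≤ 1) {b : ℝ} (hb : 0 ≤ b)
    (hf₁ : ∀ χ, ‖dft (fun x => (f₁ x : ℂ)) χ‖ ≤ b) :
    |𝔼 x, 𝔼 y, 𝔼 z, f₁ x * f₂ y * f₃ z * g₁ (-y - z) * g₂ (-x - z) * g₃ (-x - y)| ≤ b := by
  have h : 𝔼 x, 𝔼 y, 𝔼 z, f₁ x * f₂ y * f₃ z * g₁ (-y - z) * g₂ (-x - z) * g₃ (-x - y) =
      𝔼 z, 𝔼 y, (f₂ y * f₃ z * g₁ (-y - z)) * 𝔼 x, f₁ x * g₂ (-z - x) * g₃ (-y - x) := by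
    simp_rw [mul_expect]
    rw [expect_comm]
    conv_rhs => rw [expect_comm]
    refine expect_congr rfl fun y _ => ?_
    rw [expect_comm]
    refine expect_congr rfl fun z _ => expect_congr rfl fun x _ => ?_
    rw [show -z - x = -x - z by abel, show -y - x = -x - y by abel]; ring
  rw [h]
  refine (abs_expect_le' _ _).trans (abs_expect_le_of_sq hb ?_)
  refine le_trans ?_ (expect_sq_le_of_dft_le hg₂ hg₃ hf₁)
  refine expect_le_expect fun z _ => (sq_expect_le _ _).trans (expect_le_expect fun y _ => ?_)
  rw [mul_pow]
  exact mul_le_of_le_one_left (sq_nonneg _) ((sq_le_one_iff_abs_le_one _).2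
    (abs_mul_le_one (abs_mul_le_one (hf₂ y) (hf₃ z)) (hg₁ _)))

/-- The hexagonal form is controlled by the Fourier coefficients of its function of `-y-z`: for each
fixed `x` it is a bilinear form. -/
theorem abs_expect_hexagon_le_of_dft_le' {f₁ f₂ f₃ g₁ g₂ g₃ : G → ℝ} (hf₁ : ∀ x, |f₁ x| ≤ 1)
    (hf₂ : ∀ x, |f₂ x| ≤ 1) (hf₃ : ∀ x, |f₃ x| ≤ 1) (hg₂ : ∀ x, |g₂ x| ≤ 1)
    (hg₃ : ∀ x, |g₃ x| ≤ 1) {b : ℝ} (hb : 0 ≤ b)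
    (hg₁ : ∀ χ, ‖dft (fun x => (g₁ x : ℂ)) χ‖ ≤ b) :
    |𝔼 x, 𝔼 y, 𝔼 z, f₁ x * f₂ y * f₃ z * g₁ (-y - z) * g₂ (-x - z) * g₃ (-x - y)| ≤ b := by
  have hne : (univ : Finset G).Nonempty := ⟨0, mem_univ _⟩
  refine abs_expect_le_of_forall hne fun x _ => ?_
  have h := abs_expect_bilinear_le (u := fun y => f₂ y * g₃ (-x - y))
    (v := fun z => f₁ x * f₃ z * g₂ (-x - z)) (fun y => abs_mul_le_one (hf₂ _) (hg₃ _))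
    (fun z => abs_mul_le_one (abs_mul_le_one (hf₁ _) (hf₃ _)) (hg₂ _)) hb hg₁
  refine (congrArg abs (expect_congr rfl fun y _ => expect_congr rfl fun z _ => ?_)).trans_le h
  ring

end Free

/-! ### Averages over triples with sum in a difference set -/

section

variable {G : Type*} [AddCommGroup G] [Fintype G]

section BohrAvg

/-- The average of `H x y z` over all triples for which `x + y + z` is a difference `t - s` of
elements of `F`; here `x` and `y` are uniform in `G`, and `s` and `t` are uniform in `F`. -/
noncomputable def bohrAvg (F : Finset G) (H : G → G → G → ℝ) : ℝ :=
  𝔼 s ∈ F, 𝔼 t ∈ F, 𝔼 x, 𝔼 y, H x y (t - s - x - y)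

theorem bohrAvg_mono (F : Finset G) {H H' : G → G → G → ℝ} (h : ∀ x y z, H x y z ≤ H' x y z) :
    bohrAvg F H ≤ bohrAvg F H' :=
  expect_le_expect fun _ _ => expect_le_expect fun _ _ => expect_le_expect fun _ _ =>
    expect_le_expect fun _ _ => h _ _ _

theorem bohrAvg_sub (F : Finset G) (H H' : G → G → G → ℝ) :
    bohrAvg F (fun x y z => H x y z - H' x y z) = bohrAvg F H - bohrAvg F H' := by
  simp only [bohrAvg, expect_sub_distrib]

theorem bohrAvg_add (F : Finset G) (H H' : G → G → G → ℝ) :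
    bohrAvg F (fun x y z => H x y z + H' x y z) = bohrAvg F H + bohrAvg F H' := by
  simp only [bohrAvg, expect_add_distrib]

theorem bohrAvg_sum {ι : Type*} (F : Finset G) (S : Finset ι) (H : ι → G → G → G → ℝ) :
    bohrAvg F (fun x y z => ∑ i ∈ S, H i x y z) = ∑ i ∈ S, bohrAvg F (H i) := by
  simp only [bohrAvg, expect_sum_comm]

theorem bohrAvg_const_mul (F : Finset G) (a : ℝ) (H : G → G → G → ℝ) :
    bohrAvg F (fun x y z => a * H x y z) = a * bohrAvg F H := by
  simp only [bohrAvg, mul_expect]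

theorem abs_bohrAvg_le (F : Finset G) (H : G → G → G → ℝ) :
    |bohrAvg F H| ≤ bohrAvg F fun x y z => |H x y z| :=
  (abs_expect_le' _ _).trans <| expect_le_expect fun _ _ => (abs_expect_le' _ _).trans <|
    expect_le_expect fun _ _ => (abs_expect_le' _ _).trans <|
    expect_le_expect fun _ _ => abs_expect_le' _ _

theorem abs_bohrAvg_sub_le (F : Finset G) (H H' : G → G → G → ℝ) :
    |bohrAvg F H - bohrAvg F H'| ≤ bohrAvg F fun x y z => |H x y z - H' x y z| := by
  rw [← bohrAvg_sub]; exact abs_bohrAvg_le _ _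

theorem bohrAvg_swap₁₂ (F : Finset G) (H : G → G → G → ℝ) :
    bohrAvg F (fun x y z => H y x z) = bohrAvg F H := by
  refine expect_congr rfl fun s _ => expect_congr rfl fun t _ => ?_
  rw [expect_comm]
  refine expect_congr rfl fun y _ => expect_congr rfl fun x _ => ?_
  rw [sub_right_comm]

theorem bohrAvg_swap₂₃ (F : Finset G) (H : G → G → G → ℝ) :
    bohrAvg F (fun x y z => H x z y) = bohrAvg F H := by
  refine expect_congr rfl fun s _ => expect_congr rfl fun t _ => expect_congr rfl fun x _ => ?_
  rw [← expect_sub_left _ (t - s - x)]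
  refine expect_congr rfl fun y _ => ?_
  rw [sub_sub_cancel]

theorem bohrAvg_marginal {F : Finset G} (hF : F.Nonempty) (h : G → G → ℝ) :
    bohrAvg F (fun x y _ => h x y) = 𝔼 x, 𝔼 y, h x y := by
  simp only [bohrAvg, expect_const hF]

theorem bohrAvg_const {F : Finset G} (hF : F.Nonempty) (a : ℝ) :
    bohrAvg F (fun _ _ _ => a) = a := by
  have : Nonempty G := ⟨0⟩
  rw [bohrAvg_marginal hF (fun _ _ => a)]
  simp only [Fintype.expect_const]

theorem bohrAvg_left {F : Finset G} (hF : F.Nonempty) (h : G → ℝ) :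
    bohrAvg F (fun x _ _ => h x) = 𝔼 x, h x := by
  have : Nonempty G := ⟨0⟩
  rw [bohrAvg_marginal hF (fun x _ => h x)]
  simp only [Fintype.expect_const]

theorem bohrAvg_opposite {F : Finset G} (hF : F.Nonempty) (h : G → ℝ) :
    bohrAvg F (fun _ y z => h (-y - z)) = 𝔼 x, h x := by
  have : Nonempty G := ⟨0⟩
  rw [← bohrAvg_swap₁₂ F, ← bohrAvg_swap₂₃ F, bohrAvg_marginal hF (fun x y => h (-x - y))]
  have h1 : ∀ x, 𝔼 y, h (-x - y) = 𝔼 y, h y := fun x => expect_sub_left _ _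
  simp only [h1, Fintype.expect_const]

/-- The indicator function of a finite set. -/
noncomputable def ind (F : Finset G) : G → ℝ := (F : Set G).indicator fun _ => 1

omit [AddCommGroup G] [Fintype G] in
theorem abs_ind_le_one (F : Finset G) (x : G) : |ind F x| ≤ 1 := by
  by_cases h : x ∈ F <;> simp [ind, h]

theorem expect_mem_eq {F : Finset G} (g : G → ℝ) :
    𝔼 s ∈ F, g s = ((Fintype.card G : ℝ) / #F) * 𝔼 s, ind F s * g s := by
  classical
  have : Nonempty G := ⟨0⟩
  have hG : (Fintype.card G : ℝ) ≠ 0 := by exact_mod_cast Fintype.card_ne_zero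
  rw [expect_eq_sum_div_card, Fintype.expect_eq_sum_div_card]
  have h : ∑ s, ind F s * g s = ∑ s ∈ F, g s := by
    rw [← sum_filter_add_sum_filter_not univ (· ∈ F)]
    simp only [filter_mem_eq_inter, univ_inter]
    rw [add_eq_left.2]
    · exact sum_congr rfl fun s hs => by simp [ind, hs]
    · exact sum_eq_zero fun s hs => by simp [ind, (mem_filter.1 hs).2]
  rw [h]
  field_simp

/-- Membership of `x + y + z` in the difference multiset of `F` is an average, over a parameter
`w`, of products of a function of `y` and a function of `-x-z`. -/
theorem bohrAvg_eq_expect (F : Finset G) (H : G → G → G → ℝ) :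
    bohrAvg F H = ((Fintype.card G : ℝ) / #F) ^ 2 *
      𝔼 w, 𝔼 x, 𝔼 y, 𝔼 z, ind F (w + y) * ind F (w + (-x - z)) * H x y z := by
  have h1 : ∀ x y, 𝔼 s, 𝔼 t, ind F s * (ind F t * H x y (t - s - x - y)) =
      𝔼 z, 𝔼 w, ind F (w + y) * ind F (w + (-x - z)) * H x y z := by
    intro x y
    have h2 : ∀ s, 𝔼 t, ind F s * (ind F t * H x y (t - s - x - y)) =
        𝔼 z, ind F s * (ind F (z + (s + x + y)) * H x y z) := by
      intro s
      rw [← expect_add_right _ (s + x + y)]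
      refine expect_congr rfl fun z _ => ?_
      rw [show z + (s + x + y) - s - x - y = z by abel]
    simp_rw [h2]
    rw [expect_comm]
    refine expect_congr rfl fun z _ => ?_
    rw [← expect_add_right _ (-x - z)]
    refine expect_congr rfl fun w _ => ?_
    rw [show z + (w + (-x - z) + x + y) = w + y by abel]; ring
  have h3 : 𝔼 w, 𝔼 x, 𝔼 y, 𝔼 z, ind F (w + y) * ind F (w + (-x - z)) * H x y z =
      𝔼 x, 𝔼 y, 𝔼 z, 𝔼 w, ind F (w + y) * ind F (w + (-x - z)) * H x y z := by
    rw [expect_comm]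
    refine expect_congr rfl fun x _ => ?_
    rw [expect_comm]
    refine expect_congr rfl fun y _ => ?_
    rw [expect_comm]
  rw [h3]
  simp_rw [← h1]
  rw [bohrAvg, expect_mem_eq]
  have h4 : ∀ s, 𝔼 t ∈ F, 𝔼 x, 𝔼 y, H x y (t - s - x - y) = ((Fintype.card G : ℝ) / #F) *
      𝔼 x, 𝔼 y, 𝔼 t, ind F t * H x y (t - s - x - y) := by
    intro s
    rw [expect_mem_eq]
    congr 1
    simp_rw [mul_expect]
    rw [expect_comm]
    refine expect_congr rfl fun x _ => ?_
    rw [expect_comm]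
  have h5 : 𝔼 s, ind F s * 𝔼 t ∈ F, 𝔼 x, 𝔼 y, H x y (t - s - x - y) =
      ((Fintype.card G : ℝ) / #F) *
        𝔼 x, 𝔼 y, 𝔼 s, 𝔼 t, ind F s * (ind F t * H x y (t - s - x - y)) := by
    simp_rw [h4, ← mul_expect]
    have h6 : ∀ s, ind F s * ((Fintype.card G : ℝ) / #F *
        𝔼 x, 𝔼 y, 𝔼 t, ind F t * H x y (t - s - x - y)) = (Fintype.card G : ℝ) / #F *
        𝔼 x, 𝔼 y, ind F s * 𝔼 t, ind F t * H x y (t - s - x - y) := by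
      intro s
      simp_rw [← mul_expect]; ring
    simp_rw [h6, ← mul_expect]
    congr 1
    simp_rw [mul_expect]
    rw [expect_comm]
    refine expect_congr rfl fun x _ => ?_
    rw [expect_comm]
  rw [h5]; ring

theorem abs_bohrAvg_le_of_forall (F : Finset G) (H : G → G → G → ℝ) {b : ℝ}
    (h : ∀ w, |𝔼 x, 𝔼 y, 𝔼 z, ind F (w + y) * ind F (w + (-x - z)) * H x y z| ≤ b) :
    |bohrAvg F H| ≤ ((Fintype.card G : ℝ) / #F) ^ 2 * b := by
  rw [bohrAvg_eq_expect, abs_mul, abs_of_nonneg (sq_nonneg _)]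
  gcongr
  exact abs_expect_le_of_forall ⟨0, mem_univ _⟩ fun w _ => h w

end BohrAvg

section Hexagon

/-- The average over `x + y + z ∈ F - F` of a product of functions of
`x`, `y`, `z`, `-y-z`, `-x-z`, `-x-y`. -/
noncomputable def hexagon (F : Finset G) (f₁ f₂ f₃ g₁ g₂ g₃ : G → ℝ) : ℝ :=
  bohrAvg F fun x y z => f₁ x * f₂ y * f₃ z * g₁ (-y - z) * g₂ (-x - z) * g₃ (-x - y)

variable {F : Finset G} {f₁ f₂ f₃ g₁ g₂ g₃ : G → ℝ}

theorem hexagon_swap₁₂ : hexagon F f₁ f₂ f₃ g₁ g₂ g₃ = hexagon F f₂ f₁ f₃ g₂ g₁ g₃ := by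
  rw [hexagon, ← bohrAvg_swap₁₂]
  refine congrArg (bohrAvg F) (funext fun x => funext fun y => funext fun z => ?_)
  rw [sub_eq_add_neg (-y) x, add_comm (-y), ← sub_eq_add_neg]; ring

theorem hexagon_swap₂₃ : hexagon F f₁ f₂ f₃ g₁ g₂ g₃ = hexagon F f₁ f₃ f₂ g₁ g₃ g₂ := by
  rw [hexagon, ← bohrAvg_swap₂₃]
  refine congrArg (bohrAvg F) (funext fun x => funext fun y => funext fun z => ?_)
  rw [sub_eq_add_neg (-z) y, add_comm (-z), ← sub_eq_add_neg]; ring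

theorem hexagon_sub_left (f₁' : G → ℝ) :
    hexagon F (fun x => f₁ x - f₁' x) f₂ f₃ g₁ g₂ g₃ =
      hexagon F f₁ f₂ f₃ g₁ g₂ g₃ - hexagon F f₁' f₂ f₃ g₁ g₂ g₃ := by
  rw [hexagon, hexagon, hexagon, ← bohrAvg_sub]
  refine congrArg (bohrAvg F) (funext fun x => funext fun y => funext fun z => ?_)
  ring

theorem hexagon_sub_right (g₁' : G → ℝ) :
    hexagon F f₁ f₂ f₃ (fun x => g₁ x - g₁' x) g₂ g₃ =
      hexagon F f₁ f₂ f₃ g₁ g₂ g₃ - hexagon F f₁ f₂ f₃ g₁' g₂ g₃ := by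
  rw [hexagon, hexagon, hexagon, ← bohrAvg_sub]
  refine congrArg (bohrAvg F) (funext fun x => funext fun y => funext fun z => ?_)
  ring

theorem abs_hexagon_le_of_dft_left (hf₂ : ∀ x, |f₂ x| ≤ 1)
    (hf₃ : ∀ x, |f₃ x| ≤ 1) (hg₁ : ∀ x, |g₁ x| ≤ 1) (hg₂ : ∀ x, |g₂ x| ≤ 1)
    (hg₃ : ∀ x, |g₃ x| ≤ 1) {b : ℝ} (hb : 0 ≤ b)
    (hf₁ : ∀ χ, ‖dft (fun x => (f₁ x : ℂ)) χ‖ ≤ b) :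
    |hexagon F f₁ f₂ f₃ g₁ g₂ g₃| ≤ ((Fintype.card G : ℝ) / #F) ^ 2 * b := by
  refine abs_bohrAvg_le_of_forall F _ fun w => ?_
  have h := abs_expect_hexagon_le_of_dft_le (f₁ := f₁) (f₂ := fun y => ind F (w + y) * f₂ y)
    (g₂ := fun x => ind F (w + x) * g₂ x) (fun y => abs_mul_le_one (abs_ind_le_one F _) (hf₂ y))
    hf₃ hg₁ (fun y => abs_mul_le_one (abs_ind_le_one F _) (hg₂ y)) hg₃ hb hf₁
  refine (congrArg abs (expect_congr rfl fun x _ => expect_congr rfl fun y _ =>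
    expect_congr rfl fun z _ => ?_)).trans_le h
  ring

theorem abs_hexagon_le_of_dft_right (hf₁ : ∀ x, |f₁ x| ≤ 1) (hf₂ : ∀ x, |f₂ x| ≤ 1)
    (hf₃ : ∀ x, |f₃ x| ≤ 1) (hg₂ : ∀ x, |g₂ x| ≤ 1)
    (hg₃ : ∀ x, |g₃ x| ≤ 1) {b : ℝ} (hb : 0 ≤ b)
    (hg₁ : ∀ χ, ‖dft (fun x => (g₁ x : ℂ)) χ‖ ≤ b) :
    |hexagon F f₁ f₂ f₃ g₁ g₂ g₃| ≤ ((Fintype.card G : ℝ) / #F) ^ 2 * b := by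
  refine abs_bohrAvg_le_of_forall F _ fun w => ?_
  have h := abs_expect_hexagon_le_of_dft_le' (f₁ := f₁) (f₂ := fun y => ind F (w + y) * f₂ y)
    (g₂ := fun x => ind F (w + x) * g₂ x) hf₁
    (fun y => abs_mul_le_one (abs_ind_le_one F _) (hf₂ y))
    hf₃ (fun y => abs_mul_le_one (abs_ind_le_one F _) (hg₂ y)) hg₃ hb hg₁
  refine (congrArg abs (expect_congr rfl fun x _ => expect_congr rfl fun y _ =>
    expect_congr rfl fun z _ => ?_)).trans_le h
  ring

theorem abs_hexagon_le_expect_left (hF : F.Nonempty) (hf₂ : ∀ x, |f₂ x| ≤ 1)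
    (hf₃ : ∀ x, |f₃ x| ≤ 1) (hg₁ : ∀ x, |g₁ x| ≤ 1) (hg₂ : ∀ x, |g₂ x| ≤ 1)
    (hg₃ : ∀ x, |g₃ x| ≤ 1) :
    |hexagon F f₁ f₂ f₃ g₁ g₂ g₃| ≤ 𝔼 x, |f₁ x| := by
  refine (abs_bohrAvg_le _ _).trans ((bohrAvg_mono F fun x y z => ?_).trans
    (bohrAvg_left hF fun x => |f₁ x|).le)
  rw [show f₁ x * f₂ y * f₃ z * g₁ (-y - z) * g₂ (-x - z) * g₃ (-x - y) =
    f₁ x * (f₂ y * f₃ z * g₁ (-y - z) * g₂ (-x - z) * g₃ (-x - y)) by ring, abs_mul]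
  exact mul_le_of_le_one_right (abs_nonneg _) (abs_mul_le_one (abs_mul_le_one (abs_mul_le_one
    (abs_mul_le_one (hf₂ _) (hf₃ _)) (hg₁ _)) (hg₂ _)) (hg₃ _))

theorem abs_hexagon_le_expect_right (hF : F.Nonempty) (hf₁ : ∀ x, |f₁ x| ≤ 1)
    (hf₂ : ∀ x, |f₂ x| ≤ 1) (hf₃ : ∀ x, |f₃ x| ≤ 1) (hg₂ : ∀ x, |g₂ x| ≤ 1)
    (hg₃ : ∀ x, |g₃ x| ≤ 1) :
    |hexagon F f₁ f₂ f₃ g₁ g₂ g₃| ≤ 𝔼 x, |g₁ x| := by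
  refine (abs_bohrAvg_le _ _).trans ((bohrAvg_mono F fun x y z => ?_).trans
    (bohrAvg_opposite hF fun x => |g₁ x|).le)
  rw [show f₁ x * f₂ y * f₃ z * g₁ (-y - z) * g₂ (-x - z) * g₃ (-x - y) =
    g₁ (-y - z) * (f₁ x * f₂ y * f₃ z * g₂ (-x - z) * g₃ (-x - y)) by ring, abs_mul]
  exact mul_le_of_le_one_right (abs_nonneg _) (abs_mul_le_one (abs_mul_le_one (abs_mul_le_one
    (abs_mul_le_one (hf₁ _) (hf₂ _)) (hf₃ _)) (hg₂ _)) (hg₃ _))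

end Hexagon

section Replace

variable {F₀ F₁ F₂ : Finset G} {τ : ℝ}

omit [Fintype G] in
theorem abs_smooth_le {F : Finset G} (hF : F.Nonempty) {u : G → ℝ} {b : ℝ}
    (hu : ∀ x, |u x| ≤ b) (x : G) : |smooth F u x| ≤ b :=
  abs_expect_le_of_forall hF fun _ _ => abs_expect_le_of_forall hF fun _ _ => hu _

/-- A function with values in `[-1, 1]` fitted by the three scales, with error `τ ^ 2`. -/
structure Fitted (F₀ F₁ F₂ : Finset G) (τ : ℝ) (u : G → ℝ) : Prop where
  bound : ∀ x, |u x| ≤ 1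
  good : GoodScales u (τ ^ 2) F₀ F₁ F₂

theorem fitted_one (h₀ : F₀.Nonempty) (h₂ : F₂.Nonempty) :
    Fitted F₀ F₁ F₂ τ fun _ => 1 := by
  have h : ∀ {F : Finset G}, F.Nonempty → smooth F (fun _ => 1) = fun _ => 1 := by
    intro F hF
    ext x
    simp [smooth, expect_const hF]
  refine ⟨fun _ => by simp, ⟨?_, fun χ => ?_, ?_⟩⟩
  · simp [h h₀, h h₂, sq_nonneg]
  · simp [h h₂, dft, sq_nonneg]
  · simp [h h₀, sq_nonneg]

variable {f₁ f₂ f₃ g₁ g₂ g₃ : G → ℝ}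

/-- A fitted function may be replaced by its average at scale `F₀`: the difference is the sum of a
part with tiny Fourier coefficients and a part that is small in `L²`. -/
theorem abs_hexagon_sub_smooth_left (h₁ : F₁.Nonempty) (hτ : 0 ≤ τ)
    (hτ1 : τ ≤ 1) (hf₁ : Fitted F₀ F₁ F₂ τ f₁) (hf₂ : ∀ x, |f₂ x| ≤ 1)
    (hf₃ : ∀ x, |f₃ x| ≤ 1) (hg₁ : ∀ x, |g₁ x| ≤ 1) (hg₂ : ∀ x, |g₂ x| ≤ 1)
    (hg₃ : ∀ x, |g₃ x| ≤ 1) :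
    |hexagon F₁ f₁ f₂ f₃ g₁ g₂ g₃ - hexagon F₁ (smooth F₀ f₁) f₂ f₃ g₁ g₂ g₃| ≤ 2 * τ := by
  have hK : 0 < ((Fintype.card G : ℝ) / #F₁) ^ 2 := by
    have : Nonempty G := ⟨0⟩
    have h1 : (0 : ℝ) < Fintype.card G := by exact_mod_cast Fintype.card_pos
    have h2 : (0 : ℝ) < #F₁ := by exact_mod_cast h₁.card_pos
    positivity
  have e1 := abs_hexagon_le_of_dft_left (F := F₁) (f₁ := fun x => f₁ x - smooth F₂ f₁ x)
    hf₂ hf₃ hg₁ hg₂ hg₃ (b := τ ^ 2 / ((Fintype.card G : ℝ) / #F₁) ^ 2) (by positivity)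
    (fun χ => by rw [le_div_iff₀' hK]; exact hf₁.good.unif χ)
  have e2 := abs_hexagon_le_expect_left (F := F₁)
    (f₁ := fun x => smooth F₂ f₁ x - smooth F₀ f₁ x) h₁ hf₂ hf₃ hg₁ hg₂ hg₃
  have e3 := abs_expect_le_of_sq hτ hf₁.good.close
  rw [mul_div_cancel₀ _ hK.ne', hexagon_sub_left] at e1
  rw [hexagon_sub_left] at e2
  have e4 := abs_sub_le (hexagon F₁ f₁ f₂ f₃ g₁ g₂ g₃)
    (hexagon F₁ (smooth F₂ f₁) f₂ f₃ g₁ g₂ g₃) (hexagon F₁ (smooth F₀ f₁) f₂ f₃ g₁ g₂ g₃)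
  nlinarith

theorem abs_hexagon_sub_smooth_right (h₁ : F₁.Nonempty) (hτ : 0 ≤ τ)
    (hτ1 : τ ≤ 1) (hg₁ : Fitted F₀ F₁ F₂ τ g₁) (hf₁ : ∀ x, |f₁ x| ≤ 1) (hf₂ : ∀ x, |f₂ x| ≤ 1)
    (hf₃ : ∀ x, |f₃ x| ≤ 1) (hg₂ : ∀ x, |g₂ x| ≤ 1) (hg₃ : ∀ x, |g₃ x| ≤ 1) :
    |hexagon F₁ f₁ f₂ f₃ g₁ g₂ g₃ - hexagon F₁ f₁ f₂ f₃ (smooth F₀ g₁) g₂ g₃| ≤ 2 * τ := by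
  have hK : 0 < ((Fintype.card G : ℝ) / #F₁) ^ 2 := by
    have : Nonempty G := ⟨0⟩
    have h1 : (0 : ℝ) < Fintype.card G := by exact_mod_cast Fintype.card_pos
    have h2 : (0 : ℝ) < #F₁ := by exact_mod_cast h₁.card_pos
    positivity
  have e1 := abs_hexagon_le_of_dft_right (F := F₁) (g₁ := fun x => g₁ x - smooth F₂ g₁ x)
    hf₁ hf₂ hf₃ hg₂ hg₃ (b := τ ^ 2 / ((Fintype.card G : ℝ) / #F₁) ^ 2) (by positivity)
    (fun χ => by rw [le_div_iff₀' hK]; exact hg₁.good.unif χ)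
  have e2 := abs_hexagon_le_expect_right (F := F₁)
    (g₁ := fun x => smooth F₂ g₁ x - smooth F₀ g₁ x) h₁ hf₁ hf₂ hf₃ hg₂ hg₃
  have e3 := abs_expect_le_of_sq hτ hg₁.good.close
  rw [mul_div_cancel₀ _ hK.ne', hexagon_sub_right] at e1
  rw [hexagon_sub_right] at e2
  have e4 := abs_sub_le (hexagon F₁ f₁ f₂ f₃ g₁ g₂ g₃)
    (hexagon F₁ f₁ f₂ f₃ (smooth F₂ g₁) g₂ g₃) (hexagon F₁ f₁ f₂ f₃ (smooth F₀ g₁) g₂ g₃)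
  nlinarith

theorem abs_hexagon_sub_hexagon_smooth (h₀ : F₀.Nonempty) (h₁ : F₁.Nonempty)
    (hτ : 0 ≤ τ) (hτ1 : τ ≤ 1) (hf₁ : Fitted F₀ F₁ F₂ τ f₁) (hf₂ : Fitted F₀ F₁ F₂ τ f₂)
    (hf₃ : Fitted F₀ F₁ F₂ τ f₃) (hg₁ : Fitted F₀ F₁ F₂ τ g₁) (hg₂ : Fitted F₀ F₁ F₂ τ g₂)
    (hg₃ : Fitted F₀ F₁ F₂ τ g₃) :
    |hexagon F₁ f₁ f₂ f₃ g₁ g₂ g₃ - hexagon F₁ (smooth F₀ f₁) (smooth F₀ f₂) (smooth F₀ f₃)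
      (smooth F₀ g₁) (smooth F₀ g₂) (smooth F₀ g₃)| ≤ 12 * τ := by
  have s : ∀ {u}, Fitted F₀ F₁ F₂ τ u → ∀ x, |smooth F₀ u x| ≤ 1 := fun h => abs_smooth_le h₀ h.bound
  have a1 := abs_hexagon_sub_smooth_left h₁ hτ hτ1 hf₁ hf₂.bound hf₃.bound hg₁.bound hg₂.bound
    hg₃.bound
  have a2 := abs_hexagon_sub_smooth_right h₁ hτ hτ1 hg₁ (s hf₁) hf₂.bound hf₃.bound hg₂.bound
    hg₃.bound
  have a3 := abs_hexagon_sub_smooth_left h₁ hτ hτ1 hf₂ (s hf₁) hf₃.bound hg₂.bound (s hg₁)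
    hg₃.bound
  have a4 := abs_hexagon_sub_smooth_right h₁ hτ hτ1 hg₂ (s hf₂) (s hf₁) hf₃.bound (s hg₁)
    hg₃.bound
  have a5 := abs_hexagon_sub_smooth_left h₁ hτ hτ1 hf₃ (s hf₁) (s hf₂) hg₃.bound (s hg₁) (s hg₂)
  have a6 := abs_hexagon_sub_smooth_right h₁ hτ hτ1 hg₃ (s hf₃) (s hf₁) (s hf₂) (s hg₁) (s hg₂)
  rw [hexagon_swap₁₂, hexagon_swap₁₂ (f₁ := smooth F₀ f₂)] at a3 a4
  rw [hexagon_swap₁₂, hexagon_swap₂₃, hexagon_swap₁₂ (f₁ := smooth F₀ f₃),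
    hexagon_swap₂₃ (f₂ := smooth F₀ f₃)] at a5 a6
  rw [abs_le] at *
  constructor <;> linarith [a1.1, a2.1, a3.1, a4.1, a5.1, a6.1, a1.2, a2.2, a3.2, a4.2, a5.2, a6.2]

/-- At scale `F₀` the arguments `-y-z` and `x` are interchangeable, as their difference lies in
`F₁ - F₁`. -/
theorem bohrAvg_abs_shift_le (hτ : 0 ≤ τ) {u : G → ℝ} (hu : Fitted F₀ F₁ F₂ τ u) :
    bohrAvg F₁ (fun x y z => |smooth F₀ u (-y - z) - smooth F₀ u x|) ≤ τ := by
  have : Nonempty G := ⟨0⟩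
  have h1 : bohrAvg F₁ (fun x y z => |smooth F₀ u (-y - z) - smooth F₀ u x|) =
      𝔼 s ∈ F₁, 𝔼 t ∈ F₁, 𝔼 x, |smooth F₀ u (x + (t - s)) - smooth F₀ u x| := by
    rw [bohrAvg, expect_comm]
    refine expect_congr rfl fun s _ => expect_congr rfl fun t _ => expect_congr rfl fun x _ => ?_
    rw [← Fintype.expect_const (ι := G) (|smooth F₀ u (x + (t - s)) - smooth F₀ u x|)]
    refine expect_congr rfl fun y _ => ?_
    rw [show -y - (s - t - x - y) = x + (t - s) by abel]
  rw [h1]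
  refine le_of_sq_le_sq ?_ hτ
  refine le_trans ?_ hu.good.shift
  refine (sq_expect_le _ _).trans (expect_le_expect fun s _ => ?_)
  refine (sq_expect_le _ _).trans (expect_le_expect fun t _ => ?_)
  refine (sq_expect_le _ _).trans (expect_le_expect fun x _ => ?_)
  rw [sq_abs]

/-- The hexagonal form of fitted functions only depends on their local averages, and these may all
be evaluated at `x`, `y` and `z`. -/
theorem abs_hexagon_sub_bohrAvg_smooth (h₀ : F₀.Nonempty) (h₁ : F₁.Nonempty)
    (hτ : 0 ≤ τ) (hτ1 : τ ≤ 1) (hf₁ : Fitted F₀ F₁ F₂ τ f₁) (hf₂ : Fitted F₀ F₁ F₂ τ f₂)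
    (hf₃ : Fitted F₀ F₁ F₂ τ f₃) (hg₁ : Fitted F₀ F₁ F₂ τ g₁) (hg₂ : Fitted F₀ F₁ F₂ τ g₂)
    (hg₃ : Fitted F₀ F₁ F₂ τ g₃) :
    |hexagon F₁ f₁ f₂ f₃ g₁ g₂ g₃ - bohrAvg F₁ (fun x y z =>
      smooth F₀ f₁ x * smooth F₀ f₂ y * smooth F₀ f₃ z *
      smooth F₀ g₁ x * smooth F₀ g₂ y * smooth F₀ g₃ z)| ≤ 15 * τ := by
  have s : ∀ {u}, Fitted F₀ F₁ F₂ τ u → ∀ x, |smooth F₀ u x| ≤ 1 := fun h => abs_smooth_le h₀ h.bound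
  have e1 := abs_hexagon_sub_hexagon_smooth h₀ h₁ hτ hτ1 hf₁ hf₂ hf₃ hg₁ hg₂ hg₃
  have b1 := bohrAvg_abs_shift_le hτ hg₁
  have b2 := bohrAvg_abs_shift_le hτ hg₂
  have b3 := bohrAvg_abs_shift_le hτ hg₃
  rw [← bohrAvg_swap₁₂] at b2
  rw [← bohrAvg_swap₁₂, ← bohrAvg_swap₂₃] at b3
  have e2 := abs_bohrAvg_sub_le F₁ (fun x y z => smooth F₀ f₁ x * smooth F₀ f₂ y * smooth F₀ f₃ z *
      smooth F₀ g₁ (-y - z) * smooth F₀ g₂ (-x - z) * smooth F₀ g₃ (-x - y)) (fun x y z =>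
      smooth F₀ f₁ x * smooth F₀ f₂ y * smooth F₀ f₃ z *
      smooth F₀ g₁ x * smooth F₀ g₂ y * smooth F₀ g₃ z)
  have e3 : bohrAvg F₁ (fun x y z => |smooth F₀ f₁ x * smooth F₀ f₂ y * smooth F₀ f₃ z *
      smooth F₀ g₁ (-y - z) * smooth F₀ g₂ (-x - z) * smooth F₀ g₃ (-x - y) -
      smooth F₀ f₁ x * smooth F₀ f₂ y * smooth F₀ f₃ z *
      smooth F₀ g₁ x * smooth F₀ g₂ y * smooth F₀ g₃ z|) ≤
      bohrAvg F₁ (fun x y z => (|smooth F₀ g₁ (-y - z) - smooth F₀ g₁ x| +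
        |smooth F₀ g₂ (-x - z) - smooth F₀ g₂ y|) + |smooth F₀ g₃ (-x - y) - smooth F₀ g₃ z|) := by
    refine bohrAvg_mono F₁ fun x y z => ?_
    have hp : |smooth F₀ f₁ x * smooth F₀ f₂ y * smooth F₀ f₃ z| ≤ 1 :=
      abs_mul_le_one (abs_mul_le_one (s hf₁ _) (s hf₂ _)) (s hf₃ _)
    generalize smooth F₀ f₁ x * smooth F₀ f₂ y * smooth F₀ f₃ z = p at hp
    have c1 : |p * smooth F₀ g₂ (-x - z) * smooth F₀ g₃ (-x - y)| ≤ 1 :=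
      abs_mul_le_one (abs_mul_le_one hp (s hg₂ _)) (s hg₃ _)
    have c2 : |p * smooth F₀ g₁ x * smooth F₀ g₃ (-x - y)| ≤ 1 :=
      abs_mul_le_one (abs_mul_le_one hp (s hg₁ _)) (s hg₃ _)
    have c3 : |p * smooth F₀ g₁ x * smooth F₀ g₂ y| ≤ 1 :=
      abs_mul_le_one (abs_mul_le_one hp (s hg₁ _)) (s hg₂ _)
    generalize smooth F₀ g₁ x = a at *
    generalize smooth F₀ g₁ (-y - z) = a' at *
    generalize smooth F₀ g₂ y = b at *
    generalize smooth F₀ g₂ (-x - z) = b' at *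
    generalize smooth F₀ g₃ z = d at *
    generalize smooth F₀ g₃ (-x - y) = d' at *
    rw [show p * a' * b' * d' - p * a * b * d =
      (a' - a) * (p * b' * d') + (b' - b) * (p * a * d') + (d' - d) * (p * a * b) by ring]
    refine (abs_add_le _ _).trans (add_le_add ((abs_add_le _ _).trans (add_le_add ?_ ?_)) ?_)
    all_goals rw [abs_mul]; exact mul_le_of_le_one_right (abs_nonneg _) (by assumption)
  rw [bohrAvg_add F₁ (fun x y z => |smooth F₀ g₁ (-y - z) - smooth F₀ g₁ x| +
    |smooth F₀ g₂ (-x - z) - smooth F₀ g₂ y|), bohrAvg_add] at e3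
  rw [hexagon, hexagon] at e1
  refine (abs_sub_le _ _ _).trans ((add_le_add e1 (e2.trans e3)).trans ?_)
  linarith

end Replace

end

/-! ### The corner functional on finite probability spaces -/

section FiniteFunctional

variable {κ : Type*} [Fintype κ]

/-- The corner functional of a function on a product of three copies of a finite set, each carrying
a weight. -/
noncomputable def weightedT (p q s : κ → ℝ) (Φ : κ → κ → κ → ℝ) : ℝ :=
  ∑ i, ∑ j, ∑ k, p i * q j * s k *
    ((∑ k', s k' * Φ i j k') * (∑ j', q j' * Φ i j' k) * (∑ i', p i' * Φ i' j k))

/-- The mean of a function on a product of three weighted finite sets. -/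
noncomputable def weightedMean (p q s : κ → ℝ) (Φ : κ → κ → κ → ℝ) : ℝ :=
  ∑ i, ∑ j, ∑ k, p i * q j * s k * Φ i j k

variable {p q s : κ → ℝ} (hp : p ∈ stdSimplex ℝ κ) (hq : q ∈ stdSimplex ℝ κ)
  (hs : s ∈ stdSimplex ℝ κ) {Φ Ψ : κ → κ → κ → ℝ}

include hp hq hs

theorem weightedMean_mono (h : ∀ i j k, Φ i j k ≤ Ψ i j k) :
    weightedMean p q s Φ ≤ weightedMean p q s Ψ :=
  sum_le_sum fun i _ => sum_le_sum fun j _ => sum_le_sum fun k _ =>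
    mul_le_mul_of_nonneg_left (h i j k) (mul_nonneg (mul_nonneg (hp.1 i) (hq.1 j)) (hs.1 k))

theorem weightedMean_const (a : ℝ) : weightedMean p q s (fun _ _ _ => a) = a := by
  simp only [weightedMean, mul_assoc, ← mul_sum, ← sum_mul, hp.2, hq.2, hs.2, one_mul]

theorem weightedMean_mem_Icc (h0 : ∀ i j k, 0 ≤ Φ i j k) (h1 : ∀ i j k, Φ i j k ≤ 1) :
    weightedMean p q s Φ ∈ Set.Icc (0 : ℝ) 1 :=
  ⟨(weightedMean_const hp hq hs 0).ge.trans (weightedMean_mono hp hq hs h0),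
    (weightedMean_mono hp hq hs h1).trans (weightedMean_const hp hq hs 1).le⟩

theorem weightedT_mono (h0 : ∀ i j k, 0 ≤ Φ i j k) (h : ∀ i j k, Φ i j k ≤ Ψ i j k) :
    weightedT p q s Φ ≤ weightedT p q s Ψ := by
  have n : ∀ {r : κ → ℝ}, r ∈ stdSimplex ℝ κ → ∀ {a : κ → ℝ}, (∀ i, 0 ≤ a i) →
      0 ≤ ∑ i, r i * a i := fun hr _ ha => sum_nonneg fun i _ => mul_nonneg (hr.1 i) (ha i)
  have m : ∀ {r : κ → ℝ}, r ∈ stdSimplex ℝ κ → ∀ {a b : κ → ℝ}, (∀ i, a i ≤ b i) →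
      ∑ i, r i * a i ≤ ∑ i, r i * b i := fun hr _ _ ha =>
    sum_le_sum fun i _ => mul_le_mul_of_nonneg_left (ha i) (hr.1 i)
  refine sum_le_sum fun i _ => sum_le_sum fun j _ => sum_le_sum fun k _ =>
    mul_le_mul_of_nonneg_left ?_ (mul_nonneg (mul_nonneg (hp.1 i) (hq.1 j)) (hs.1 k))
  have a1 := m hs fun k' => h i j k'
  have a2 := m hq fun j' => h i j' k
  have a3 := m hp fun i' => h i' j k
  have b1 := n hs fun k' => h0 i j k'
  have b2 := n hq fun j' => h0 i j' k
  have b3 := n hp fun i' => h0 i' j k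
  exact mul_le_mul (mul_le_mul a1 a2 b2 (b1.trans a1)) a3 b3
    (mul_nonneg (b1.trans a1) (b2.trans a2))

/-- Raising `Φ` raises the corner functional by at most three times the rise of the mean. -/
theorem weightedT_sub_le (h0 : ∀ i j k, 0 ≤ Φ i j k) (h : ∀ i j k, Φ i j k ≤ Ψ i j k)
    (h1 : ∀ i j k, Ψ i j k ≤ 1) :
    weightedT p q s Ψ - weightedT p q s Φ ≤
      3 * (weightedMean p q s Ψ - weightedMean p q s Φ) := by
  have n : ∀ {r : κ → ℝ}, r ∈ stdSimplex ℝ κ → ∀ {a : κ → ℝ}, (∀ i, 0 ≤ a i) →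
      0 ≤ ∑ i, r i * a i := fun hr _ ha => sum_nonneg fun i _ => mul_nonneg (hr.1 i) (ha i)
  have m : ∀ {r : κ → ℝ}, r ∈ stdSimplex ℝ κ → ∀ {a b : κ → ℝ}, (∀ i, a i ≤ b i) →
      ∑ i, r i * a i ≤ ∑ i, r i * b i := fun hr _ _ ha =>
    sum_le_sum fun i _ => mul_le_mul_of_nonneg_left (ha i) (hr.1 i)
  have o : ∀ {r : κ → ℝ}, r ∈ stdSimplex ℝ κ → ∀ {a : κ → ℝ}, (∀ i, a i ≤ 1) →
      ∑ i, r i * a i ≤ 1 := fun hr _ ha => (m hr ha).trans (by simp [hr.2])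
  have key : ∀ a b c a' b' c' : ℝ, 0 ≤ a → 0 ≤ b → 0 ≤ c → a ≤ a' → b ≤ b' → c ≤ c' →
      a' ≤ 1 → b' ≤ 1 → c' ≤ 1 →
      a' * b' * c' - a * b * c ≤ (a' - a) + (b' - b) + (c' - c) := by
    intro a b c a' b' c' ha hb hc haa hbb hcc ha1 hb1 hc1
    have e1 : (a' - a) * (b' * c') ≤ (a' - a) * 1 :=
      mul_le_mul_of_nonneg_left (mul_le_one₀ hb1 (hc.trans hcc) hc1) (by linarith)
    have e2 : (b' - b) * (a * c') ≤ (b' - b) * 1 :=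
      mul_le_mul_of_nonneg_left (mul_le_one₀ (haa.trans ha1) (hc.trans hcc) hc1) (by linarith)
    have e3 : (c' - c) * (a * b) ≤ (c' - c) * 1 :=
      mul_le_mul_of_nonneg_left (mul_le_one₀ (haa.trans ha1) hb (hbb.trans hb1)) (by linarith)
    linarith
  have hT : weightedT p q s Ψ - weightedT p q s Φ ≤ ∑ i, ∑ j, ∑ k, p i * q j * s k *
      (((∑ k', s k' * Ψ i j k') - (∑ k', s k' * Φ i j k')) +
        ((∑ j', q j' * Ψ i j' k) - (∑ j', q j' * Φ i j' k)) +
        ((∑ i', p i' * Ψ i' j k) - (∑ i', p i' * Φ i' j k))) := by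
    simp only [weightedT, ← sum_sub_distrib, ← mul_sub]
    refine sum_le_sum fun i _ => sum_le_sum fun j _ => sum_le_sum fun k _ =>
      mul_le_mul_of_nonneg_left ?_ (mul_nonneg (mul_nonneg (hp.1 i) (hq.1 j)) (hs.1 k))
    simp only [mul_sub, sum_sub_distrib]
    exact key _ _ _ _ _ _ (n hs fun k' => h0 i j k') (n hq fun j' => h0 i j' k)
      (n hp fun i' => h0 i' j k) (m hs fun k' => h i j k') (m hq fun j' => h i j' k)
      (m hp fun i' => h i' j k) (o hs fun k' => h1 i j k') (o hq fun j' => h1 i j' k)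
      (o hp fun i' => h1 i' j k)
  refine hT.trans (le_of_eq ?_)
  have c1 : ∀ Θ : κ → κ → κ → ℝ, ∑ i, ∑ j, ∑ k, p i * q j * s k * (∑ k', s k' * Θ i j k') =
      weightedMean p q s Θ := by
    intro Θ
    refine sum_congr rfl fun i _ => sum_congr rfl fun j _ => ?_
    rw [← sum_mul, ← mul_sum, hs.2, mul_one, mul_sum]
    exact sum_congr rfl fun k _ => by ring
  have c2 : ∀ Θ : κ → κ → κ → ℝ, ∑ i, ∑ j, ∑ k, p i * q j * s k * (∑ j', q j' * Θ i j' k) =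
      weightedMean p q s Θ := by
    intro Θ
    refine sum_congr rfl fun i _ => ?_
    rw [sum_comm]
    conv_rhs => rw [sum_comm]
    refine sum_congr rfl fun k _ => ?_
    rw [← sum_mul, ← sum_mul, ← mul_sum, hq.2, mul_one, mul_sum]
    exact sum_congr rfl fun j _ => by ring
  have c3 : ∀ Θ : κ → κ → κ → ℝ, ∑ i, ∑ j, ∑ k, p i * q j * s k * (∑ i', p i' * Θ i' j k) =
      weightedMean p q s Θ := by
    intro Θ
    rw [weightedMean, sum_comm]
    conv_rhs => rw [sum_comm]
    refine sum_congr rfl fun j _ => ?_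
    rw [sum_comm]
    conv_rhs => rw [sum_comm]
    refine sum_congr rfl fun k _ => ?_
    rw [← sum_mul, ← sum_mul, ← sum_mul, hp.2, one_mul, mul_sum]
    exact sum_congr rfl fun i _ => by ring
  simp only [mul_add, mul_sub, sum_add_distrib, sum_sub_distrib, c1, c2, c3]
  ring

end FiniteFunctional

section UnitInterval

/-- A finite probability space is the image of the unit interval. -/
theorem exists_map_unitInterval {κ : Type*} [Fintype κ] [MeasurableSpace κ]
    [DiscreteMeasurableSpace κ] {p : κ → ℝ} (hp : p ∈ stdSimplex ℝ κ) :
    ∃ (μ : Measure κ) (X : unitInterval → κ), IsProbabilityMeasure μ ∧ Measurable X ∧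
      Measure.map X volume = μ ∧ ∀ h : κ → ℝ, ∫ i, h i ∂μ = ∑ i, p i * h i := by
  have hne : Nonempty κ := by
    by_contra hcon
    have : IsEmpty κ := not_nonempty_iff.1 hcon
    have h := hp.2
    simp at h
  let μ : Measure κ := Measure.sum fun i => ENNReal.ofReal (p i) • Measure.dirac i
  have hμi : ∀ i, μ {i} = ENNReal.ofReal (p i) := by
    classical
    intro i
    simp only [μ]
    rw [Measure.sum_apply _ (MeasurableSet.singleton i)]
    simp only [tsum_fintype, Measure.smul_apply, smul_eq_mul, Measure.dirac_apply,
      Set.indicator_apply, Set.mem_singleton_iff, Pi.one_apply, mul_ite, mul_one, mul_zero,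
      sum_ite_eq', mem_univ, if_true]
  have hμ : IsProbabilityMeasure μ := by
    constructor
    simp only [μ]
    rw [Measure.sum_apply _ MeasurableSet.univ]
    simp only [tsum_fintype, Measure.smul_apply, smul_eq_mul, measure_univ, mul_one]
    rw [← ENNReal.ofReal_sum_of_nonneg fun i _ => hp.1 i, hp.2, ENNReal.ofReal_one]
  obtain ⟨X, hX, hmap⟩ := Measure.exists_measurable_map_eq μ
  refine ⟨μ, X, hμ, hX, hmap, fun h => ?_⟩
  rw [integral_fintype Integrable.of_finite]
  refine sum_congr rfl fun i _ => ?_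
  rw [Measure.real, hμi, ENNReal.toReal_ofReal (hp.1 i), smul_eq_mul]

theorem cornerInf_le {φ : unitInterval × unitInterval × unitInterval → unitInterval}
    (hφ : Measurable φ) {a : ℝ} (ha : ∫ p, (φ p : ℝ) = a) :
    cornerInf a ≤ cornerFunctional φ := by
  refine csInf_le ⟨0, ?_⟩ ⟨φ, hφ, ha, rfl⟩
  rintro t ⟨ψ, -, -, rfl⟩
  exact integral_nonneg fun p => mul_nonneg (mul_nonneg (integral_nonneg fun _ => (ψ _).2.1)
    (integral_nonneg fun _ => (ψ _).2.1)) (integral_nonneg fun _ => (ψ _).2.1)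

/-- The finite corner functional is the corner functional of a step function on the unit cube. -/
theorem cornerInf_weightedMean_le {κ : Type*} [Fintype κ] {p q s : κ → ℝ}
    (hp : p ∈ stdSimplex ℝ κ) (hq : q ∈ stdSimplex ℝ κ) (hs : s ∈ stdSimplex ℝ κ)
    {Φ : κ → κ → κ → ℝ} (h0 : ∀ i j k, 0 ≤ Φ i j k) (h1 : ∀ i j k, Φ i j k ≤ 1) :
    cornerInf (weightedMean p q s Φ) ≤ weightedT p q s Φ := by
  let _ : MeasurableSpace κ := ⊤
  have : DiscreteMeasurableSpace κ := ⟨fun _ => trivial⟩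
  obtain ⟨μ, X, hμ, hX, hXμ, hμint⟩ := exists_map_unitInterval hp
  obtain ⟨ν, Y, hν, hY, hYν, hνint⟩ := exists_map_unitInterval hq
  obtain ⟨ξ, Z, hξ, hZ, hZξ, hξint⟩ := exists_map_unitInterval hs
  let Θ : κ × κ × κ → unitInterval := fun t => ⟨Φ t.1 t.2.1 t.2.2, h0 _ _ _, h1 _ _ _⟩
  let M : unitInterval × unitInterval × unitInterval → κ × κ × κ := Prod.map X (Prod.map Y Z)
  have hM : Measurable M := hX.prodMap (hY.prodMap hZ)
  have hmap : Measure.map M volume = μ.prod (ν.prod ξ) := by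
    have e1 : (volume : Measure (unitInterval × unitInterval)) = volume.prod volume := rfl
    have e2 : (volume : Measure (unitInterval × unitInterval × unitInterval)) =
      volume.prod volume := rfl
    rw [e2, ← Measure.map_prod_map _ _ hX (hY.prodMap hZ), e1, ← Measure.map_prod_map _ _ hY hZ,
      hXμ, hYν, hZξ]
  have hint3 : ∀ h : κ × κ × κ → ℝ, ∫ t, h (M t) = ∑ i, ∑ j, ∑ k, p i * q j * s k * h (i, j, k) := by
    intro h
    rw [← integral_map (f := h) hM.aemeasurable (measurable_of_finite h).aestronglyMeasurable, hmap,
      integral_prod _ Integrable.of_finite, hμint]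
    refine sum_congr rfl fun i _ => ?_
    rw [integral_prod _ Integrable.of_finite, hνint, mul_sum]
    refine sum_congr rfl fun j _ => ?_
    rw [hξint, mul_sum, mul_sum]
    exact sum_congr rfl fun k _ => by ring
  have hint1 : ∀ {r : κ → ℝ} {W : unitInterval → κ} {ρ : Measure κ}, Measurable W →
      Measure.map W volume = ρ → (∀ h : κ → ℝ, ∫ i, h i ∂ρ = ∑ i, r i * h i) →
      ∀ h : κ → ℝ, ∫ t, h (W t) = ∑ i, r i * h i := by
    intro r W ρ hW hWρ hρ h
    rw [← integral_map (f := h) hW.aemeasurable (measurable_of_finite h).aestronglyMeasurable, hWρ,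
      hρ]
  have hΘ : Measurable fun t => Θ (M t) := (measurable_of_finite Θ).comp hM
  refine (cornerInf_le hΘ (hint3 fun t => (Θ t : ℝ))).trans (le_of_eq ?_)
  rw [cornerFunctional]
  have e3 := hint3 fun t => (∑ k', s k' * Φ t.1 t.2.1 k') * (∑ j', q j' * Φ t.1 j' t.2.2) *
    (∑ i', p i' * Φ i' t.2.1 t.2.2)
  refine Eq.trans (integral_congr_ae (Filter.Eventually.of_forall fun t => ?_)) e3
  simp only
  congr 1
  · congr 1
    · exact hint1 hZ hZξ hξint fun k => Φ (X t.1) (Y t.2.1) k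
    · exact hint1 hY hYν hνint fun j => Φ (X t.1) j (Z t.2.2)
  · exact hint1 hX hXμ hμint fun i => Φ i (Y t.2.1) (Z t.2.2)

end UnitInterval

/-! ### Corner counts of functions of colours -/

section

variable {G : Type*} [AddCommGroup G] [Fintype G]

section Jensen

theorem map_expect_le_of_convexOn {ι : Type*} {S : Finset ι} (hS : S.Nonempty) {D : Set ℝ}
    {g : ℝ → ℝ} (hg : ConvexOn ℝ D g) {f : ι → ℝ} (hf : ∀ i ∈ S, f i ∈ D) :
    𝔼 i ∈ S, f i ∈ D ∧ g (𝔼 i ∈ S, f i) ≤ 𝔼 i ∈ S, g (f i) := by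
  have hS' : (0 : ℝ) < #S := by exact_mod_cast hS.card_pos
  have e : ∀ h : ι → ℝ, 𝔼 i ∈ S, h i = ∑ i ∈ S, (1 / (#S : ℝ)) • h i := by
    intro h
    rw [expect_eq_sum_div_card, ← smul_sum, smul_eq_mul]; ring
  have hw : ∑ i ∈ S, 1 / (#S : ℝ) = 1 := by
    rw [sum_const, nsmul_eq_mul]; field_simp
  rw [e, e]
  exact ⟨hg.1.sum_mem (fun _ _ => by positivity) hw hf,
    hg.map_sum_le (fun _ _ => by positivity) hw hf⟩

theorem map_bohrAvg_le_of_convexOn {F : Finset G} (hF : F.Nonempty) {D : Set ℝ} {g : ℝ → ℝ}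
    (hg : ConvexOn ℝ D g) {H : G → G → G → ℝ} (hH : ∀ x y z, H x y z ∈ D) :
    g (bohrAvg F H) ≤ bohrAvg F fun x y z => g (H x y z) := by
  have hu : (univ : Finset G).Nonempty := ⟨0, mem_univ _⟩
  have h1 := fun s t x => map_expect_le_of_convexOn (f := fun y => H x y (t - s - x - y)) hu hg
    fun y _ => hH _ _ _
  have h2 := fun s t => map_expect_le_of_convexOn hu hg fun x _ => (h1 s t x).1
  have h3 := fun s => map_expect_le_of_convexOn hF hg fun t _ => (h2 s t).1
  have h4 := map_expect_le_of_convexOn hF hg fun s _ => (h3 s).1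
  refine h4.2.trans (expect_le_expect fun s _ => ?_)
  refine (h3 s).2.trans (expect_le_expect fun t _ => ?_)
  refine (h2 s t).2.trans (expect_le_expect fun x _ => ?_)
  exact (h1 s t x).2

end Jensen

section Colours

variable {κ : Type*} [DecidableEq κ]

/-- The indicator function of a colour class. -/
def level (c : G → κ) (i : κ) (x : G) : ℝ := if c x = i then 1 else 0

omit [AddCommGroup G] [Fintype G] in
theorem abs_level_le_one (c : G → κ) (i : κ) (x : G) : |level c i x| ≤ 1 := by
  unfold level; split_ifs <;> simp

variable [Fintype κ]

omit [AddCommGroup G] [Fintype G] in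
theorem sum_level_mul (c : G → κ) (x : G) (h : κ → ℝ) : ∑ i, level c i x * h i = h (c x) := by
  simp [level]

/-- The proportions of the colours near a point, at scale `F`. -/
noncomputable def localDensity (F : Finset G) (c : G → κ) (x : G) : κ → ℝ :=
  fun i => smooth F (level c i) x

omit [Fintype G] in
theorem localDensity_mem_stdSimplex {F : Finset G} (hF : F.Nonempty) (c : G → κ) (x : G) :
    localDensity F c x ∈ stdSimplex ℝ κ := by
  constructor
  · intro i
    refine expect_nonneg fun s _ => expect_nonneg fun t _ => ?_
    unfold level; split_ifs <;> simp
  · simp only [localDensity, smooth, ← expect_sum_comm]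
    have h : ∀ y, ∑ i, level c i y = 1 := fun y => by simp [level]
    simp only [h, expect_const hF]

/-- The average number of corners spanned by `f`, with a difference drawn from `F - F`. -/
noncomputable def cornerCount (F : Finset G) (f : G → G → ℝ) : ℝ :=
  bohrAvg F fun x y z => f x y * f x (-x - z) * f (-y - z) y

variable {F₀ F₁ F₂ : Finset G} {τ : ℝ} {c₁ c₂ c₃ : G → κ}

/-- The corner count of a function of the colours of `x`, `y` and `-x-y` is the average over `F₁`
of the corner functional for the local colour densities. -/
theorem abs_cornerCount_sub_weightedT (h₀ : F₀.Nonempty) (h₁ : F₁.Nonempty) (hτ : 0 ≤ τ)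
    (hτ1 : τ ≤ 1) (hc₁ : ∀ i, Fitted F₀ F₁ F₂ τ (level c₁ i))
    (hc₂ : ∀ i, Fitted F₀ F₁ F₂ τ (level c₂ i)) (hc₃ : ∀ i, Fitted F₀ F₁ F₂ τ (level c₃ i))
    {Φ : κ → κ → κ → ℝ} (hΦ : ∀ i j k, |Φ i j k| ≤ 1) :
    |cornerCount F₁ (fun x y => Φ (c₁ x) (c₂ y) (c₃ (-x - y))) -
      bohrAvg F₁ (fun x y z => weightedT (localDensity F₀ c₁ x) (localDensity F₀ c₂ y)
        (localDensity F₀ c₃ z) Φ)| ≤ (Fintype.card κ : ℝ) ^ 6 * (15 * τ) := by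
  have e1 : cornerCount F₁ (fun x y => Φ (c₁ x) (c₂ y) (c₃ (-x - y))) =
      ∑ i, ∑ j, ∑ k, ∑ k', ∑ j', ∑ i', (Φ i j k' * Φ i j' k * Φ i' j k) *
        hexagon F₁ (level c₁ i) (level c₂ j) (level c₃ k) (level c₁ i') (level c₂ j')
          (level c₃ k') := by
    simp only [hexagon, ← bohrAvg_const_mul, ← bohrAvg_sum]
    refine congrArg (bohrAvg F₁) (funext fun x => funext fun y => funext fun z => ?_)
    symm
    calc _ = ∑ i, level c₁ i x * ∑ j, level c₂ j y * ∑ k, level c₃ k z *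
          ∑ k', level c₃ k' (-x - y) * ∑ j', level c₂ j' (-x - z) * ∑ i', level c₁ i' (-y - z) *
            (Φ i j k' * Φ i j' k * Φ i' j k) := by
          simp only [mul_sum]
          refine sum_congr rfl fun i _ => sum_congr rfl fun j _ => sum_congr rfl fun k _ =>
            sum_congr rfl fun k' _ => sum_congr rfl fun j' _ => sum_congr rfl fun i' _ => ?_
          ring
      _ = _ := by
          simp only [sum_level_mul]
          rw [show -x - (-x - z) = z by abel, show -(-y - z) - y = z by abel]
  have e2 : bohrAvg F₁ (fun x y z => weightedT (localDensity F₀ c₁ x) (localDensity F₀ c₂ y)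
        (localDensity F₀ c₃ z) Φ) =
      ∑ i, ∑ j, ∑ k, ∑ k', ∑ j', ∑ i', (Φ i j k' * Φ i j' k * Φ i' j k) *
        bohrAvg F₁ (fun x y z => smooth F₀ (level c₁ i) x * smooth F₀ (level c₂ j) y *
          smooth F₀ (level c₃ k) z * smooth F₀ (level c₁ i') x * smooth F₀ (level c₂ j') y *
          smooth F₀ (level c₃ k') z) := by
    simp only [← bohrAvg_const_mul, ← bohrAvg_sum]
    refine congrArg (bohrAvg F₁) (funext fun x => funext fun y => funext fun z => ?_)
    refine sum_congr rfl fun i _ => sum_congr rfl fun j _ => sum_congr rfl fun k _ => ?_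
    rw [sum_mul_sum, sum_mul, mul_sum]
    refine sum_congr rfl fun k' _ => ?_
    rw [sum_mul_sum, mul_sum]
    refine sum_congr rfl fun j' _ => ?_
    rw [mul_sum]
    refine sum_congr rfl fun i' _ => ?_
    simp only [localDensity]
    ring
  have hb : ∀ {A B : κ → ℝ} {b : ℝ}, (∀ i, |A i - B i| ≤ b) →
      |∑ i, A i - ∑ i, B i| ≤ Fintype.card κ * b := by
    intro A B b h
    rw [← sum_sub_distrib]
    refine (abs_sum_le_sum_abs _ _).trans ((sum_le_sum fun i _ => h i).trans ?_)
    simp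
  rw [e1, e2, show (Fintype.card κ : ℝ) ^ 6 * (15 * τ) = Fintype.card κ * (Fintype.card κ *
    (Fintype.card κ * (Fintype.card κ * (Fintype.card κ * (Fintype.card κ * (15 * τ)))))) by ring]
  refine hb fun i => hb fun j => hb fun k => hb fun k' => hb fun j' => hb fun i' => ?_
  rw [← mul_sub, abs_mul]
  refine (mul_le_of_le_one_left (abs_nonneg _)
    (abs_mul_le_one (abs_mul_le_one (hΦ _ _ _) (hΦ _ _ _)) (hΦ _ _ _))).trans ?_
  exact abs_hexagon_sub_bohrAvg_smooth h₀ h₁ hτ hτ1 (hc₁ i) (hc₂ j) (hc₃ k) (hc₁ i') (hc₂ j')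
    (hc₃ k')

/-- The mean of a function of the colours is the average of its local means; this is the hexagonal
form with three of the six functions equal to `1`. -/
theorem abs_expect_sub_weightedMean (h₀ : F₀.Nonempty) (h₁ : F₁.Nonempty) (h₂ : F₂.Nonempty)
    (hτ : 0 ≤ τ) (hτ1 : τ ≤ 1) (hc₁ : ∀ i, Fitted F₀ F₁ F₂ τ (level c₁ i))
    (hc₂ : ∀ i, Fitted F₀ F₁ F₂ τ (level c₂ i)) (hc₃ : ∀ i, Fitted F₀ F₁ F₂ τ (level c₃ i))
    {Φ : κ → κ → κ → ℝ} (hΦ : ∀ i j k, |Φ i j k| ≤ 1) :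
    |𝔼 x, 𝔼 y, Φ (c₁ x) (c₂ y) (c₃ (-x - y)) -
      bohrAvg F₁ (fun x y z => weightedMean (localDensity F₀ c₁ x) (localDensity F₀ c₂ y)
        (localDensity F₀ c₃ z) Φ)| ≤ (Fintype.card κ : ℝ) ^ 3 * (15 * τ) := by
  have e1 : 𝔼 x, 𝔼 y, Φ (c₁ x) (c₂ y) (c₃ (-x - y)) =
      ∑ i, ∑ j, ∑ k, Φ i j k *
        hexagon F₁ (level c₁ i) (level c₂ j) (fun _ => 1) (fun _ => 1) (fun _ => 1)
          (level c₃ k) := by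
    rw [← bohrAvg_marginal h₁]
    simp only [hexagon, ← bohrAvg_const_mul, ← bohrAvg_sum]
    refine congrArg (bohrAvg F₁) (funext fun x => funext fun y => funext fun z => ?_)
    symm
    calc _ = ∑ i, level c₁ i x * ∑ j, level c₂ j y * ∑ k, level c₃ k (-x - y) * Φ i j k := by
          simp only [mul_sum]
          refine sum_congr rfl fun i _ => sum_congr rfl fun j _ => sum_congr rfl fun k _ => ?_
          ring
      _ = _ := by simp only [sum_level_mul]
  have hone : ∀ x, smooth F₀ (fun _ : G => 1) x = 1 := fun x => by
    simp only [smooth, expect_const h₀]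
  have e2 : bohrAvg F₁ (fun x y z => weightedMean (localDensity F₀ c₁ x) (localDensity F₀ c₂ y)
        (localDensity F₀ c₃ z) Φ) =
      ∑ i, ∑ j, ∑ k, Φ i j k *
        bohrAvg F₁ (fun x y z => smooth F₀ (level c₁ i) x * smooth F₀ (level c₂ j) y *
          smooth F₀ (fun _ => 1) z * smooth F₀ (fun _ => 1) x * smooth F₀ (fun _ => 1) y *
          smooth F₀ (level c₃ k) z) := by
    simp only [← bohrAvg_const_mul, ← bohrAvg_sum]
    refine congrArg (bohrAvg F₁) (funext fun x => funext fun y => funext fun z => ?_)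
    refine sum_congr rfl fun i _ => sum_congr rfl fun j _ => sum_congr rfl fun k _ => ?_
    simp only [hone, localDensity]
    ring
  have hb : ∀ {A B : κ → ℝ} {b : ℝ}, (∀ i, |A i - B i| ≤ b) →
      |∑ i, A i - ∑ i, B i| ≤ Fintype.card κ * b := by
    intro A B b h
    rw [← sum_sub_distrib]
    refine (abs_sum_le_sum_abs _ _).trans ((sum_le_sum fun i _ => h i).trans ?_)
    simp
  rw [e1, e2, show (Fintype.card κ : ℝ) ^ 3 * (15 * τ) = Fintype.card κ * (Fintype.card κ *
    (Fintype.card κ * (15 * τ))) by ring]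
  refine hb fun i => hb fun j => hb fun k => ?_
  rw [← mul_sub, abs_mul]
  refine (mul_le_of_le_one_left (abs_nonneg _) (hΦ _ _ _)).trans ?_
  have h1 : Fitted F₀ F₁ F₂ τ fun _ => 1 := fitted_one h₀ h₂
  exact abs_hexagon_sub_bohrAvg_smooth h₀ h₁ hτ hτ1 (hc₁ i) (hc₂ j) h1 h1 h1 (hc₃ k)

/-- `Φ` can be scaled, towards `0` or towards `1`, so that its average becomes exactly `α`;
this lowers the average of the corner functional by at most three times the change of the mean. -/
theorem exists_adjusted (h₀ : F₀.Nonempty) (h₁ : F₁.Nonempty) {Φ : κ → κ → κ → ℝ}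
    (h0 : ∀ i j k, 0 ≤ Φ i j k) (h1 : ∀ i j k, Φ i j k ≤ 1) {α β : ℝ} (hα0 : 0 ≤ α) (hα1 : α ≤ 1)
    (hβ : bohrAvg F₁ (fun x y z => weightedMean (localDensity F₀ c₁ x) (localDensity F₀ c₂ y)
        (localDensity F₀ c₃ z) Φ) = β) :
    ∃ Ψ : κ → κ → κ → ℝ, (∀ i j k, 0 ≤ Ψ i j k) ∧ (∀ i j k, Ψ i j k ≤ 1) ∧
      bohrAvg F₁ (fun x y z => weightedMean (localDensity F₀ c₁ x) (localDensity F₀ c₂ y)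
        (localDensity F₀ c₃ z) Ψ) = α ∧
      bohrAvg F₁ (fun x y z => weightedT (localDensity F₀ c₁ x) (localDensity F₀ c₂ y)
        (localDensity F₀ c₃ z) Ψ) ≤
      bohrAvg F₁ (fun x y z => weightedT (localDensity F₀ c₁ x) (localDensity F₀ c₂ y)
        (localDensity F₀ c₃ z) Φ) + 3 * |α - β| := by
  have hd := fun (c : G → κ) x => localDensity_mem_stdSimplex h₀ c x
  have hβ0 : 0 ≤ β := by
    rw [← hβ, ← bohrAvg_const h₁ 0]
    exact bohrAvg_mono _ fun x y z =>
      (weightedMean_mem_Icc (hd c₁ x) (hd c₂ y) (hd c₃ z) h0 h1).1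
  have hβ1 : β ≤ 1 := by
    rw [← hβ, ← bohrAvg_const h₁ 1]
    exact bohrAvg_mono _ fun x y z =>
      (weightedMean_mem_Icc (hd c₁ x) (hd c₂ y) (hd c₃ z) h0 h1).2
  rcases le_total α β with hαβ | hαβ
  -- If the mean is too large, scale towards `0`, which lowers the functional.
  · obtain ⟨t, ht0, ht1, ht⟩ : ∃ t : ℝ, 0 ≤ t ∧ t ≤ 1 ∧ t * β = α := by
      rcases hβ0.eq_or_lt with rfl | hpos
      · exact ⟨0, le_rfl, zero_le_one, by linarith⟩
      · exact ⟨α / β, by positivity, div_le_one_of_le₀ hαβ hβ0, div_mul_cancel₀ _ hpos.ne'⟩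
    refine ⟨fun i j k => t * Φ i j k, fun i j k => mul_nonneg ht0 (h0 i j k),
      fun i j k => mul_le_one₀ ht1 (h0 i j k) (h1 i j k), ?_, ?_⟩
    · rw [← ht, ← hβ, ← bohrAvg_const_mul]
      refine congrArg (bohrAvg F₁) (funext fun x => funext fun y => funext fun z => ?_)
      simp only [weightedMean, mul_sum]
      refine sum_congr rfl fun i _ => sum_congr rfl fun j _ => sum_congr rfl fun k _ => ?_
      ring
    · refine le_add_of_le_of_nonneg (bohrAvg_mono _ fun x y z => ?_) (by positivity)
      exact weightedT_mono (hd c₁ x) (hd c₂ y) (hd c₃ z) (fun i j k => mul_nonneg ht0 (h0 i j k))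
        fun i j k => mul_le_of_le_one_left (h0 i j k) ht1
  -- If the mean is too small, scale towards `1`.
  · obtain ⟨t, ht0, ht1, ht⟩ : ∃ t : ℝ, 0 ≤ t ∧ t ≤ 1 ∧ t * (1 - β) = 1 - α := by
      rcases hβ1.eq_or_lt with rfl | hlt
      · exact ⟨0, le_rfl, zero_le_one, by linarith⟩
      · have : 0 < 1 - β := by linarith
        exact ⟨(1 - α) / (1 - β), div_nonneg (by linarith) this.le,
          div_le_one_of_le₀ (by linarith) this.le, div_mul_cancel₀ _ this.ne'⟩
    have hΨ : ∀ i j k, Φ i j k ≤ (1 - t) + t * Φ i j k := fun i j k => by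
      nlinarith [h1 i j k]
    have hΨ1 : ∀ i j k, (1 - t) + t * Φ i j k ≤ 1 := fun i j k => by nlinarith [h1 i j k]
    have hmean : ∀ x y z, weightedMean (localDensity F₀ c₁ x) (localDensity F₀ c₂ y)
        (localDensity F₀ c₃ z) (fun i j k => (1 - t) + t * Φ i j k) = (1 - t) +
        t * weightedMean (localDensity F₀ c₁ x) (localDensity F₀ c₂ y) (localDensity F₀ c₃ z) Φ := by
      intro x y z
      conv_rhs => rw [← weightedMean_const (hd c₁ x) (hd c₂ y) (hd c₃ z) (1 - t)]
      simp only [weightedMean, mul_sum, ← sum_add_distrib]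
      refine sum_congr rfl fun i _ => sum_congr rfl fun j _ => sum_congr rfl fun k _ => ?_
      ring
    have hαmean : bohrAvg F₁ (fun x y z => weightedMean (localDensity F₀ c₁ x)
        (localDensity F₀ c₂ y) (localDensity F₀ c₃ z) fun i j k => (1 - t) + t * Φ i j k) = α := by
      simp only [hmean]
      rw [bohrAvg_add F₁ (fun _ _ _ => 1 - t), bohrAvg_const h₁, bohrAvg_const_mul, hβ]
      linarith
    refine ⟨fun i j k => (1 - t) + t * Φ i j k, fun i j k => (h0 i j k).trans (hΨ i j k), hΨ1,
      hαmean, ?_⟩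
    rw [abs_of_nonneg (sub_nonneg.2 hαβ), ← sub_le_iff_le_add', ← bohrAvg_sub]
    refine (bohrAvg_mono F₁ fun x y z => weightedT_sub_le (hd c₁ x) (hd c₂ y) (hd c₃ z) h0 hΨ
      hΨ1).trans (le_of_eq ?_)
    rw [bohrAvg_const_mul, bohrAvg_sub, hβ, hαmean]

/-- Jensen's inequality, applied to the local means of `Φ`, bounds the corner count from below by a
convex minorant of `m`. -/
theorem le_cornerCount_of_fitted (h₀ : F₀.Nonempty) (h₁ : F₁.Nonempty) (h₂ : F₂.Nonempty)
    (hτ : 0 ≤ τ) (hτ1 : τ ≤ 1) (hc₁ : ∀ i, Fitted F₀ F₁ F₂ τ (level c₁ i))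
    (hc₂ : ∀ i, Fitted F₀ F₁ F₂ τ (level c₂ i)) (hc₃ : ∀ i, Fitted F₀ F₁ F₂ τ (level c₃ i))
    {Φ : κ → κ → κ → ℝ} (h0 : ∀ i j k, 0 ≤ Φ i j k) (h1 : ∀ i j k, Φ i j k ≤ 1)
    {g : ℝ → ℝ} (hg : ConvexOn ℝ (Set.Icc 0 1) g) (hgm : ∀ β ∈ Set.Icc (0 : ℝ) 1, g β ≤ cornerInf β)
    {α : ℝ} (hα0 : 0 ≤ α) (hα1 : α ≤ 1) (hα : 𝔼 x, 𝔼 y, Φ (c₁ x) (c₂ y) (c₃ (-x - y)) = α) :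
    g α ≤ cornerCount F₁ (fun x y => Φ (c₁ x) (c₂ y) (c₃ (-x - y))) +
      60 * (Fintype.card κ : ℝ) ^ 6 * τ := by
  have hd := fun (c : G → κ) x => localDensity_mem_stdSimplex h₀ c x
  have hΦ : ∀ i j k, |Φ i j k| ≤ 1 := fun i j k => by
    rw [abs_of_nonneg (h0 i j k)]; exact h1 i j k
  have e1 := abs_cornerCount_sub_weightedT h₀ h₁ hτ hτ1 hc₁ hc₂ hc₃ hΦ
  have e2 := abs_expect_sub_weightedMean h₀ h₁ h₂ hτ hτ1 hc₁ hc₂ hc₃ hΦ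
  rw [hα] at e2
  obtain ⟨Ψ, hΨ0, hΨ1, hmean, hT⟩ := exists_adjusted (c₁ := c₁) (c₂ := c₂) (c₃ := c₃) h₀ h₁ h0 h1
    hα0 hα1 rfl
  have e3 : g α ≤ bohrAvg F₁ (fun x y z => weightedT (localDensity F₀ c₁ x) (localDensity F₀ c₂ y)
        (localDensity F₀ c₃ z) Ψ) := by
    rw [← hmean]
    refine (map_bohrAvg_le_of_convexOn h₁ hg fun x y z =>
      weightedMean_mem_Icc (hd c₁ x) (hd c₂ y) (hd c₃ z) hΨ0 hΨ1).trans (bohrAvg_mono _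
      fun x y z => ?_)
    exact (hgm _ (weightedMean_mem_Icc (hd c₁ x) (hd c₂ y) (hd c₃ z) hΨ0 hΨ1)).trans
      (cornerInf_weightedMean_le (hd c₁ x) (hd c₂ y) (hd c₃ z) hΨ0 hΨ1)
  have hκ : (Fintype.card κ : ℝ) ^ 3 ≤ (Fintype.card κ : ℝ) ^ 6 := by
    have : (1 : ℝ) ≤ Fintype.card κ := by
      have : Nonempty κ := ⟨c₁ 0⟩
      exact_mod_cast Fintype.card_pos
    exact pow_le_pow_right₀ this (by norm_num)
  have e4 := mul_le_mul_of_nonneg_right hκ (by linarith : 0 ≤ 45 * τ)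
  have e5 := (abs_le.1 e1).1
  linarith

end Colours

end

/-! ### Cut norms and corner counts -/

section

variable {G : Type*} [AddCommGroup G] [Fintype G]

section Cut

/-- A bound for the (normalised) cut norm of a matrix indexed by `G × G`. -/
def CutBounded (A : G → G → ℝ) (η : ℝ) : Prop :=
  ∀ U V : Finset G, |𝔼 x, 𝔼 y, A x y * ind U x * ind V y| ≤ η

omit [AddCommGroup G] in
/-- The worst test function with values in `[-1, 1]` is the sign of `R`, a difference of two
indicator functions. -/
theorem expect_abs_le_of_ind {R : G → ℝ} {η : ℝ} (h : ∀ U, |𝔼 x, R x * ind U x| ≤ η) :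
    𝔼 x, |R x| ≤ 2 * η := by
  classical
  have e : 𝔼 x, |R x| = 𝔼 x, R x * ind (univ.filter fun x => 0 ≤ R x) x -
      𝔼 x, R x * ind (univ.filter fun x => R x < 0) x := by
    rw [← expect_sub_distrib]
    refine expect_congr rfl fun x _ => ?_
    by_cases hx : 0 ≤ R x
    · simp [ind, hx, abs_of_nonneg hx, not_lt.2 hx]
    · simp [ind, hx, abs_of_neg (not_le.1 hx), not_le.1 hx]
  rw [e]
  have h1 := (abs_le.1 (h (univ.filter fun x => 0 ≤ R x))).2
  have h2 := (abs_le.1 (h (univ.filter fun x => R x < 0))).1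
  linarith

omit [AddCommGroup G] in
theorem abs_expect_mul_le {R u : G → ℝ} (hu : ∀ x, |u x| ≤ 1) :
    |𝔼 x, R x * u x| ≤ 𝔼 x, |R x| := by
  refine (abs_expect_le' _ _).trans (expect_le_expect fun x _ => ?_)
  rw [abs_mul]
  exact mul_le_of_le_one_right (abs_nonneg _) (hu x)

omit [AddCommGroup G] in
theorem CutBounded.abs_expect_le {A : G → G → ℝ} {η : ℝ} (hA : CutBounded A η) {u v : G → ℝ}
    (hu : ∀ x, |u x| ≤ 1) (hv : ∀ x, |v x| ≤ 1) :
    |𝔼 x, 𝔼 y, A x y * u x * v y| ≤ 4 * η := by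
  have h1 : ∀ V : Finset G, |𝔼 y, (𝔼 x, A x y * u x) * ind V y| ≤ 2 * η := by
    intro V
    have e : 𝔼 y, (𝔼 x, A x y * u x) * ind V y = 𝔼 x, (𝔼 y, A x y * ind V y) * u x := by
      simp only [expect_mul]
      rw [expect_comm]
      exact expect_congr rfl fun x _ => expect_congr rfl fun y _ => by ring
    rw [e]
    refine (abs_expect_mul_le hu).trans (expect_abs_le_of_ind fun U => ?_)
    refine le_trans (le_of_eq (congrArg abs ?_)) (hA U V)
    simp only [expect_mul]
    exact expect_congr rfl fun x _ => expect_congr rfl fun y _ => by ring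
  have e : 𝔼 x, 𝔼 y, A x y * u x * v y = 𝔼 y, (𝔼 x, A x y * u x) * v y := by
    rw [expect_comm]
    simp only [expect_mul]
  rw [e]
  refine (abs_expect_mul_le hv).trans ((expect_abs_le_of_ind h1).trans (le_of_eq ?_))
  ring

/-- In a triangle count weighted by `F - F`, a factor of small cut norm makes the count small. -/
theorem abs_bohrAvg_triangle_le (F : Finset G) {A B C : G → G → ℝ} {η : ℝ} (hA : CutBounded A η)
    (hB : ∀ x y, |B x y| ≤ 1) (hC : ∀ x y, |C x y| ≤ 1) :
    |bohrAvg F fun x y z => A x y * B x z * C y z| ≤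
      ((Fintype.card G : ℝ) / #F) ^ 2 * (4 * η) := by
  refine abs_bohrAvg_le_of_forall F _ fun w => ?_
  have e : 𝔼 x, 𝔼 y, 𝔼 z, ind F (w + y) * ind F (w + (-x - z)) * (A x y * B x z * C y z) =
      𝔼 z, 𝔼 x, 𝔼 y, A x y * (ind F (w + (-x - z)) * B x z) * (ind F (w + y) * C y z) := by
    conv_rhs => rw [expect_comm]
    refine expect_congr rfl fun x _ => ?_
    rw [expect_comm]
    exact expect_congr rfl fun z _ => expect_congr rfl fun y _ => by ring
  rw [e]
  exact abs_expect_le_of_forall ⟨0, mem_univ _⟩ fun z _ => hA.abs_expect_le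
    (fun x => abs_mul_le_one (abs_ind_le_one _ _) (hB _ _))
    (fun y => abs_mul_le_one (abs_ind_le_one _ _) (hC _ _))

/-- Smallness in cut norm of a function on `G × G` with respect to each two of the three
coordinates `x`, `y` and `z = -x-y`. -/
structure CutBounded₃ (D : G → G → ℝ) (η : ℝ) : Prop where
  xy : CutBounded D η
  xz : CutBounded (fun x z => D x (-x - z)) η
  yz : CutBounded (fun y z => D (-y - z) y) η

theorem abs_cornerCount_sub_le_of_cut (F : Finset G) {f f' : G → G → ℝ} (hf : ∀ x y, |f x y| ≤ 1)
    (hf' : ∀ x y, |f' x y| ≤ 1) {η : ℝ} (h : CutBounded₃ (fun x y => f x y - f' x y) η) :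
    |cornerCount F f - cornerCount F f'| ≤ 12 * ((Fintype.card G : ℝ) / #F) ^ 2 * η := by
  have e1 := abs_bohrAvg_triangle_le F h.xy (fun x z => hf x (-x - z)) (fun y z => hf (-y - z) y)
  have e2 := abs_bohrAvg_triangle_le F h.xz (fun x z => hf' x z) (fun y z => hf (-z - y) z)
  have e3 := abs_bohrAvg_triangle_le F h.yz (fun x z => hf' z x)
    (fun y z => hf' z (-z - y))
  rw [← bohrAvg_swap₂₃] at e2
  rw [← bohrAvg_swap₂₃, ← bohrAvg_swap₁₂] at e3
  have e : cornerCount F f - cornerCount F f' =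
      bohrAvg F (fun x y z => (f x y - f' x y) * f x (-x - z) * f (-y - z) y) +
      bohrAvg F (fun x z y => (f x (-x - y) - f' x (-x - y)) * f' x z * f (-z - y) z) +
      bohrAvg F (fun y x z => (f (-x - z) x - f' (-x - z) x) * f' y x * f' y (-y - z)) := by
    rw [cornerCount, cornerCount, ← bohrAvg_sub, ← bohrAvg_add, ← bohrAvg_add]
    refine congrArg (bohrAvg F) (funext fun x => funext fun y => funext fun z => ?_)
    ring
  rw [e]
  refine (abs_add_le _ _).trans ((add_le_add ((abs_add_le _ _).trans (add_le_add e1 e2)) e3).trans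
    (le_of_eq ?_))
  ring

theorem abs_cornerCount_sub_le_expect {F : Finset G} (hF : F.Nonempty) {f f' : G → G → ℝ}
    (hf : ∀ x y, |f x y| ≤ 1) (hf' : ∀ x y, |f' x y| ≤ 1) :
    |cornerCount F f - cornerCount F f'| ≤ 3 * 𝔼 x, 𝔼 y, |f x y - f' x y| := by
  have h1 := bohrAvg_marginal hF fun x y => |f x y - f' x y|
  have h2 : bohrAvg F (fun x _ z => |f x (-x - z) - f' x (-x - z)|) =
      𝔼 x, 𝔼 y, |f x y - f' x y| := by
    rw [← bohrAvg_swap₂₃, bohrAvg_marginal hF fun x z => |f x (-x - z) - f' x (-x - z)|]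
    exact expect_congr rfl fun x _ => expect_sub_left (fun y => |f x y - f' x y|) (-x)
  have h3 : bohrAvg F (fun _ y z => |f (-y - z) y - f' (-y - z) y|) =
      𝔼 x, 𝔼 y, |f x y - f' x y| := by
    rw [← bohrAvg_swap₁₂, ← bohrAvg_swap₂₃,
      bohrAvg_marginal hF fun y z => |f (-y - z) y - f' (-y - z) y|]
    conv_rhs => rw [expect_comm]
    exact expect_congr rfl fun y _ => expect_sub_left (fun x => |f x y - f' x y|) (-y)
  have h4 : |cornerCount F f - cornerCount F f'| ≤ bohrAvg F (fun x y z =>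
      (|f x y - f' x y| + |f x (-x - z) - f' x (-x - z)|) + |f (-y - z) y - f' (-y - z) y|) := by
    refine (abs_bohrAvg_sub_le F _ _).trans (bohrAvg_mono F fun x y z => ?_)
    have a1 := hf x (-x - z)
    have a2 := hf (-y - z) y
    have a3 := hf' x y
    have a4 := hf' x (-x - z)
    rw [show f x y * f x (-x - z) * f (-y - z) y - f' x y * f' x (-x - z) * f' (-y - z) y =
      (f x y - f' x y) * (f x (-x - z) * f (-y - z) y) +
      (f x (-x - z) - f' x (-x - z)) * (f' x y * f (-y - z) y) +
      (f (-y - z) y - f' (-y - z) y) * (f' x y * f' x (-x - z)) by ring]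
    refine (abs_add_le _ _).trans (add_le_add ((abs_add_le _ _).trans (add_le_add ?_ ?_)) ?_)
    · rw [abs_mul]; exact mul_le_of_le_one_right (abs_nonneg _) (abs_mul_le_one a1 a2)
    · rw [abs_mul]; exact mul_le_of_le_one_right (abs_nonneg _) (abs_mul_le_one a3 a2)
    · rw [abs_mul]; exact mul_le_of_le_one_right (abs_nonneg _) (abs_mul_le_one a3 a4)
  rw [bohrAvg_add F (fun x y z => |f x y - f' x y| + |f x (-x - z) - f' x (-x - z)|), bohrAvg_add,
    h1, h2, h3] at h4
  linarith

end Cut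

end

/-! ### Regularity for functions on the square of the group -/

section Conditional

variable {Ω κ κ' : Type*} [Fintype Ω] [Fintype κ] [DecidableEq κ] [Fintype κ'] [DecidableEq κ']

/-- The averages of `f` over the classes of a finite partition, given as the fibres of `col`;
the average over an empty class is `0`. -/
noncomputable def classAvg (col : Ω → κ) (f : Ω → ℝ) (k : κ) : ℝ :=
  𝔼 p ∈ univ.filter fun p => col p = k, f p

omit [Fintype κ] in
theorem classAvg_nonneg {col : Ω → κ} {f : Ω → ℝ} (hf : ∀ p, 0 ≤ f p) (k : κ) :
    0 ≤ classAvg col f k := expect_nonneg fun p _ => hf p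

omit [Fintype κ] in
theorem classAvg_le_one {col : Ω → κ} {f : Ω → ℝ} (hf : ∀ p, f p ≤ 1) (k : κ) :
    classAvg col f k ≤ 1 := by
  rcases (univ.filter fun p => col p = k).eq_empty_or_nonempty with h | h
  · simp [classAvg, h]
  · exact expect_le_of_forall_le h fun p _ => hf p

theorem expect_classAvg_mul (col : Ω → κ) (f : Ω → ℝ) (h : κ → ℝ) :
    𝔼 p, classAvg col f (col p) * h (col p) = 𝔼 p, f p * h (col p) := by
  rw [Fintype.expect_eq_sum_div_card, Fintype.expect_eq_sum_div_card]
  congr 1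
  rw [← sum_fiberwise univ col, ← sum_fiberwise univ col fun p => f p * h (col p)]
  refine sum_congr rfl fun k _ => ?_
  have e1 : ∑ p with col p = k, classAvg col f (col p) * h (col p) =
      ∑ p with col p = k, classAvg col f k * h k :=
    sum_congr rfl fun p hp => by rw [(mem_filter.1 hp).2]
  have e2 : ∑ p with col p = k, f p * h (col p) = ∑ p with col p = k, f p * h k :=
    sum_congr rfl fun p hp => by rw [(mem_filter.1 hp).2]
  rw [e1, e2, ← sum_mul, ← sum_mul, sum_const, nsmul_eq_mul, classAvg, card_mul_expect]

/-- The energy of a partition: the mean square of the conditional expectation. -/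
noncomputable def energy (col : Ω → κ) (f : Ω → ℝ) : ℝ := 𝔼 p, classAvg col f (col p) ^ 2

omit [Fintype κ] in
theorem energy_le_one {col : Ω → κ} {f : Ω → ℝ} (h0 : ∀ p, 0 ≤ f p) (h1 : ∀ p, f p ≤ 1) :
    energy col f ≤ 1 := by
  rcases isEmpty_or_nonempty Ω with h | h
  · simp [energy]
  · exact expect_le_of_forall_le univ_nonempty fun p _ =>
      pow_le_one₀ (classAvg_nonneg h0 _) (classAvg_le_one h1 _)

theorem expect_sq_classAvg_sub {col : Ω → κ} {col' : Ω → κ'} {π : κ' → κ}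
    (hπ : ∀ p, col p = π (col' p)) (f : Ω → ℝ) :
    𝔼 p, (classAvg col' f (col' p) - classAvg col f (col p)) ^ 2 =
      energy col' f - energy col f := by
  have e1 : 𝔼 p, classAvg col' f (col' p) * classAvg col f (col p) = energy col f := by
    have h1 := expect_classAvg_mul col' f fun k => classAvg col f (π k)
    have h2 := expect_classAvg_mul col f fun k => classAvg col f k
    simp only [← hπ] at h1
    rw [h1, ← h2, energy]
    simp only [sq]
  have e2 : ∀ p, (classAvg col' f (col' p) - classAvg col f (col p)) ^ 2 =
      (classAvg col' f (col' p) ^ 2 - 2 * (classAvg col' f (col' p) * classAvg col f (col p))) +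
      classAvg col f (col p) ^ 2 := fun p => by ring
  simp only [e2, expect_add_distrib, expect_sub_distrib, ← mul_expect, e1]
  simp only [energy]
  ring

/-- A test function of the finer partition that correlates with the error of the coarser
one witnesses an increase of energy. -/
theorem energy_lt_of_lt_abs_expect {col : Ω → κ} {col' : Ω → κ'} {π : κ' → κ}
    (hπ : ∀ p, col p = π (col' p)) (f : Ω → ℝ) {h : κ' → ℝ} (hh : ∀ k, |h k| ≤ 1) {η : ℝ}
    (hη : 0 ≤ η) (hlt : η < |𝔼 p, (f p - classAvg col f (col p)) * h (col' p)|) :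
    energy col f + η ^ 2 < energy col' f := by
  have e1 : 𝔼 p, (f p - classAvg col f (col p)) * h (col' p) =
      𝔼 p, (classAvg col' f (col' p) - classAvg col f (col p)) * h (col' p) := by
    simp only [sub_mul, expect_sub_distrib]
    rw [expect_classAvg_mul col' f h]
  have e2 : |𝔼 p, (f p - classAvg col f (col p)) * h (col' p)| ≤
      𝔼 p, |classAvg col' f (col' p) - classAvg col f (col p)| := by
    rw [e1]
    refine (abs_expect_le' _ _).trans (expect_le_expect fun p _ => ?_)
    rw [abs_mul]
    exact mul_le_of_le_one_right (abs_nonneg _) (hh _)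
  have e3 := sq_expect_le univ fun p => |classAvg col' f (col' p) - classAvg col f (col p)|
  simp only [sq_abs] at e3
  rw [expect_sq_classAvg_sub hπ] at e3
  have e4 := pow_lt_pow_left₀ (hlt.trans_le e2) hη two_ne_zero
  linarith

end Conditional

section Regularity

variable {G : Type*} [AddCommGroup G] [Fintype G]

/-- Three colourings of `G`, each given by the membership in `m` sets. They are applied to the
coordinates `x`, `y` and `-x-y` of a point `(x, y)`. -/
structure Colouring (G : Type*) (m : ℕ) where
  /-- the colour of `x` -/
  c₁ : G → Fin m → Bool
  /-- the colour of `y` -/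
  c₂ : G → Fin m → Bool
  /-- the colour of `-x-y` -/
  c₃ : G → Fin m → Bool

/-- The three colours of a point of `G × G`. -/
def Colouring.joint {m : ℕ} (C : Colouring G m) (p : G × G) :
    (Fin m → Bool) × (Fin m → Bool) × (Fin m → Bool) :=
  (C.c₁ p.1, C.c₂ p.2, C.c₃ (-p.1 - p.2))

/-- The conditional expectation of `f` given the three colours, as a function on `G × G`. -/
noncomputable def Colouring.proj {m : ℕ} (C : Colouring G m) (f : G → G → ℝ) (x y : G) : ℝ :=
  classAvg C.joint (fun p => f p.1 p.2) (C.joint (x, y))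

/-- The energy of the partition of `G × G` into the joint colour classes. -/
noncomputable def Colouring.energy {m : ℕ} (C : Colouring G m) (f : G → G → ℝ) : ℝ :=
  PopularCorners.energy C.joint fun p => f p.1 p.2

open Classical in
/-- The refinement of a colouring by one further set for each of the three colours. -/
noncomputable def Colouring.refine {m : ℕ} (C : Colouring G m) (U₁ U₂ U₃ : Finset G) :
    Colouring G (m + 1) where
  c₁ x := Fin.cons (decide (x ∈ U₁)) (C.c₁ x)
  c₂ x := Fin.cons (decide (x ∈ U₂)) (C.c₂ x)
  c₃ x := Fin.cons (decide (x ∈ U₃)) (C.c₃ x)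

/-- The joint colour in `C` is determined by the joint colour in `C'`. -/
def Colouring.RefinedBy {m m' : ℕ} (C : Colouring G m) (C' : Colouring G m') : Prop :=
  ∃ π : (Fin m' → Bool) × (Fin m' → Bool) × (Fin m' → Bool) →
    (Fin m → Bool) × (Fin m → Bool) × (Fin m → Bool), ∀ p, C.joint p = π (C'.joint p)

omit [Fintype G] in
theorem Colouring.refinedBy_refine {m : ℕ} (C : Colouring G m) (U₁ U₂ U₃ : Finset G) :
    C.RefinedBy (C.refine U₁ U₂ U₃) :=
  ⟨fun k => (Fin.tail k.1, Fin.tail k.2.1, Fin.tail k.2.2), fun _ => rfl⟩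

omit [Fintype G] in
theorem Colouring.RefinedBy.trans {m m' m'' : ℕ} {C : Colouring G m} {C' : Colouring G m'}
    {C'' : Colouring G m''} (h : C.RefinedBy C') (h' : C'.RefinedBy C'') : C.RefinedBy C'' := by
  obtain ⟨π, hπ⟩ := h
  obtain ⟨π', hπ'⟩ := h'
  exact ⟨π ∘ π', fun p => by rw [hπ, hπ']; rfl⟩

omit [AddCommGroup G] in
theorem expect_prod_eq (h : G × G → ℝ) : 𝔼 p, h p = 𝔼 x, 𝔼 y, h (x, y) := by
  rw [← univ_product_univ, expect_product]

theorem Colouring.expect_sq_proj_sub {m m' : ℕ} {C : Colouring G m} {C' : Colouring G m'}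
    (h : C.RefinedBy C') (f : G → G → ℝ) :
    𝔼 p : G × G, (C'.proj f p.1 p.2 - C.proj f p.1 p.2) ^ 2 = C'.energy f - C.energy f := by
  obtain ⟨π, hπ⟩ := h
  exact expect_sq_classAvg_sub hπ fun p => f p.1 p.2

omit [AddCommGroup G] [Fintype G] in
theorem ind_eq_ite [DecidableEq G] (U : Finset G) (x : G) : ind U x = if x ∈ U then 1 else 0 := by
  simp [ind, Set.indicator_apply]

/-- If the error of the conditional expectation is not small in cut norm, then one further set
for two of the three colours increases the energy. -/
theorem Colouring.exists_energy_increment {m : ℕ} (C : Colouring G m) (f : G → G → ℝ) {η : ℝ}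
    (hη : 0 ≤ η) (h : ¬ CutBounded₃ (fun x y => f x y - C.proj f x y) η) :
    ∃ C' : Colouring G (m + 1), C.RefinedBy C' ∧ C.energy f + η ^ 2 < C'.energy f := by
  classical
  have key : ∀ (U₁ U₂ U₃ : Finset G) (h : Bool → Bool → Bool → ℝ), (∀ a b c, |h a b c| ≤ 1) →
      η < |𝔼 x, 𝔼 y, (f x y - C.proj f x y) *
        h (decide (x ∈ U₁)) (decide (y ∈ U₂)) (decide (-x - y ∈ U₃))| →
      ∃ C' : Colouring G (m + 1), C.RefinedBy C' ∧ C.energy f + η ^ 2 < C'.energy f := by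
    intro U₁ U₂ U₃ h hh hlt
    obtain ⟨π, hπ⟩ := C.refinedBy_refine U₁ U₂ U₃
    refine ⟨C.refine U₁ U₂ U₃, ⟨π, hπ⟩, ?_⟩
    refine energy_lt_of_lt_abs_expect hπ (fun p => f p.1 p.2)
      (h := fun k => h (k.1 0) (k.2.1 0) (k.2.2 0)) (fun k => hh _ _ _) hη ?_
    rw [expect_prod_eq]
    exact hlt
  let b : Bool → ℝ := fun t => if t then 1 else 0
  have hb : ∀ t t', |b t * b t'| ≤ 1 := by
    intro t t'
    cases t <;> cases t' <;> simp [b]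
  have hind : ∀ (U : Finset G) x, ind U x = b (decide (x ∈ U)) := fun U x => by
    rw [ind_eq_ite]; simp [b]
  by_contra hcon
  apply h
  refine ⟨fun U V => ?_, fun U V => ?_, fun U V => ?_⟩
  · by_contra! hlt
    refine hcon (key U V ∅ (fun s t _ => b s * b t) (fun _ _ _ => hb _ _) ?_)
    simpa only [hind, mul_assoc] using hlt
  · by_contra! hlt
    refine hcon (key U ∅ V (fun s _ t => b s * b t) (fun _ _ _ => hb _ _) ?_)
    have e : ∀ x, 𝔼 y, (f x y - C.proj f x y) * (b (decide (x ∈ U)) * b (decide (-x - y ∈ V))) =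
        𝔼 z, (f x (-x - z) - C.proj f x (-x - z)) * ind U x * ind V z := by
      intro x
      rw [← expect_sub_left _ (-x)]
      refine expect_congr rfl fun z _ => ?_
      rw [sub_sub_cancel, hind, hind, mul_assoc]
    simp only [e]
    exact hlt
  · by_contra! hlt
    refine hcon (key ∅ U V (fun _ s t => b s * b t) (fun _ _ _ => hb _ _) ?_)
    have e : ∀ y, 𝔼 x, (f x y - C.proj f x y) * (b (decide (y ∈ U)) * b (decide (-x - y ∈ V))) =
        𝔼 z, (f (-y - z) y - C.proj f (-y - z) y) * ind U y * ind V z := by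
      intro y
      rw [← expect_sub_left _ (-y)]
      refine expect_congr rfl fun z _ => ?_
      rw [show -(-y - z) - y = z by abel, hind, hind, mul_assoc]
    rw [expect_comm]
    simp only [e]
    exact hlt

theorem Colouring.energy_le_one {m : ℕ} (C : Colouring G m) {f : G → G → ℝ}
    (h0 : ∀ x y, 0 ≤ f x y) (h1 : ∀ x y, f x y ≤ 1) : C.energy f ≤ 1 :=
  PopularCorners.energy_le_one (fun _ => h0 _ _) fun _ => h1 _ _

/-- Weak regularity: every colouring has a refinement, of controlled complexity, whose
conditional expectation approximates `f` in cut norm. -/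
theorem Colouring.exists_refinement_cutBounded {f : G → G → ℝ} (h0 : ∀ x y, 0 ≤ f x y)
    (h1 : ∀ x y, f x y ≤ 1) {η : ℝ} (hη : 0 ≤ η) (k : ℕ) :
    ∀ {m : ℕ} (C : Colouring G m), 1 ≤ C.energy f + k * η ^ 2 →
      ∃ m' ≤ m + k, ∃ C' : Colouring G m', C.RefinedBy C' ∧
        CutBounded₃ (fun x y => f x y - C'.proj f x y) η := by
  induction k with
  | zero =>
    intro m C hC
    refine ⟨m, le_rfl, C, ⟨id, fun _ => rfl⟩, ?_⟩
    by_contra hcon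
    obtain ⟨C', -, hlt⟩ := C.exists_energy_increment f hη hcon
    have := C'.energy_le_one h0 h1
    push_cast at hC
    nlinarith
  | succ k ih =>
    intro m C hC
    by_cases hcut : CutBounded₃ (fun x y => f x y - C.proj f x y) η
    · exact ⟨m, by omega, C, ⟨id, fun _ => rfl⟩, hcut⟩
    · obtain ⟨C', hCC', hlt⟩ := C.exists_energy_increment f hη hcut
      push_cast at hC
      obtain ⟨m'', hm'', C'', hC'', hcut'⟩ := ih C' (by linarith)
      exact ⟨m'', by omega, C'', hCC'.trans hC'', hcut'⟩

end Regularity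

/-- Strong regularity: a function `f'` that is close to `f` in cut norm is close in `L¹` to a
function of boundedly many colours of `x`, `y` and `-x-y`. The accuracy `η m'` in cut norm may
depend on the number `2 ^ m'` of these colours. The induction is on the number `k`
of energy increments by `ε ^ 2` that are left. -/
theorem exists_colouring_of_energy {ε : ℝ} (hε : 0 < ε) {η : ℕ → ℝ} (hη : ∀ m, 0 < η m) (k : ℕ) :
    ∀ m : ℕ, ∃ M : ℕ, ∀ (G : Type*) [AddCommGroup G] [Fintype G] (f : G → G → ℝ),
      (∀ x y, 0 ≤ f x y) → (∀ x y, f x y ≤ 1) → ∀ C : Colouring G m,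
      1 ≤ C.energy f + k * ε ^ 2 →
      ∃ m' ≤ M, ∃ (C' : Colouring G m') (f' : G → G → ℝ), (∀ x y, |f' x y| ≤ 1) ∧
        𝔼 x, 𝔼 y, |f' x y - C'.proj f x y| ≤ ε ∧ CutBounded₃ (fun x y => f x y - f' x y) (η m') := by
  have hstep : ∀ m : ℕ, ∃ n : ℕ, ∀ (G : Type _) [AddCommGroup G] [Fintype G] (f : G → G → ℝ),
      (∀ x y, 0 ≤ f x y) → (∀ x y, f x y ≤ 1) → ∀ C : Colouring G m,
      ∃ m' ≤ n, ∃ C' : Colouring G m', C.energy f + ε ^ 2 < C'.energy f ∨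
        ((∀ x y, |C'.proj f x y| ≤ 1) ∧ 𝔼 x, 𝔼 y, |C'.proj f x y - C.proj f x y| ≤ ε ∧
          CutBounded₃ (fun x y => f x y - C'.proj f x y) (η m)) := by
    intro m
    obtain ⟨n, hn⟩ := exists_nat_ge (1 / η m ^ 2)
    have hn' : 1 ≤ n * η m ^ 2 := by
      rwa [div_le_iff₀ (pow_pos (hη m) 2)] at hn
    refine ⟨m + n, fun G _ _ f h0 h1 C => ?_⟩
    have hC0 : 0 ≤ C.energy f := expect_nonneg fun _ _ => sq_nonneg _
    obtain ⟨m', hm', C', hCC', hcut⟩ := C.exists_refinement_cutBounded h0 h1 (hη m).le n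
      (by linarith)
    refine ⟨m', hm', C', ?_⟩
    rw [or_iff_not_imp_left, not_lt]
    intro hen
    refine ⟨fun x y => ?_, ?_, hcut⟩
    · rw [Colouring.proj, abs_of_nonneg (classAvg_nonneg (fun _ => h0 _ _) _)]
      exact classAvg_le_one (fun _ => h1 _ _) _
    · rw [← expect_prod_eq fun p => |C'.proj f p.1 p.2 - C.proj f p.1 p.2|]
      refine abs_expect_le_of_sq hε.le ?_
      rw [Colouring.expect_sq_proj_sub hCC']
      linarith
  induction k with
  | zero =>
    intro m
    obtain ⟨n, hn⟩ := hstep m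
    refine ⟨m, fun G _ _ f h0 h1 C hC => ?_⟩
    obtain ⟨m', -, C', hlt | ⟨hb, hL, hcut⟩⟩ := hn G f h0 h1 C
    · have := C'.energy_le_one h0 h1
      push_cast at hC
      nlinarith
    · exact ⟨m, le_rfl, C, _, hb, hL, hcut⟩
  | succ k ih =>
    intro m
    obtain ⟨n, hn⟩ := hstep m
    choose M hM using ih
    refine ⟨max m ((range (n + 1)).sup M), fun G _ _ f h0 h1 C hC => ?_⟩
    obtain ⟨m', hm', C', hlt | ⟨hb, hL, hcut⟩⟩ := hn G f h0 h1 C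
    · push_cast at hC
      obtain ⟨m'', hm'', rest⟩ := hM m' G f h0 h1 C' (by linarith)
      refine ⟨m'', hm''.trans (le_max_of_le_right ?_), rest⟩
      exact le_sup (f := M) (mem_range.2 (Nat.lt_succ_of_le hm'))
    · exact ⟨m, le_max_left _ _, C, _, hb, hL, hcut⟩

/-! ### The popular difference -/

theorem Colouring.expect_proj {G : Type*} [AddCommGroup G] [Fintype G] {m : ℕ}
    (C : Colouring G m) (f : G → G → ℝ) :
    𝔼 x, 𝔼 y, C.proj f x y = 𝔼 x, 𝔼 y, f x y := by
  have h := expect_classAvg_mul C.joint (fun p => f p.1 p.2) fun _ => 1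
  simp only [mul_one] at h
  rw [expect_prod_eq, expect_prod_eq] at h
  exact h

/-- Every function of mean `α` has at least about `g α` corners on average, for differences drawn
from `F - F`, where `F` is a set of density bounded below independently of the group. -/
theorem exists_le_cornerCount {g : ℝ → ℝ} (hg : ConvexOn ℝ (Set.Icc 0 1) g)
    (hgm : ∀ β ∈ Set.Icc (0 : ℝ) 1, g β ≤ cornerInf β) {α : ℝ} (hα0 : 0 ≤ α) (hα1 : α ≤ 1)
    {ε : ℝ} (hε : 0 < ε) :
    ∃ K : ℝ, 0 < K ∧ ∀ (G : Type*) [AddCommGroup G] [Fintype G] (f : G → G → ℝ),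
      (∀ x y, 0 ≤ f x y) → (∀ x y, f x y ≤ 1) → 𝔼 x, 𝔼 y, f x y = α →
      ∃ F : Finset G, F.Nonempty ∧ (Fintype.card G : ℝ) ≤ K * #F ∧
        g α ≤ cornerCount F f + ε := by
  -- For `2 ^ m` colours, `τ m` is the accuracy to which the scales fit the colour classes, and
  -- `K m` bounds the inverse density of the middle scale. The cut norm accuracy `ε / (36 * K m ^ 2)` may
  -- depend on `K m`, since the scales only depend on the colouring.
  obtain ⟨τ, hτdef⟩ : ∃ τ : ℕ → ℝ, ∀ m, τ m = min 1 (ε / (180 * ((2 : ℝ) ^ m) ^ 6)) :=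
    ⟨_, fun _ => rfl⟩
  have hτ : ∀ m, 0 < τ m := fun m => by
    rw [hτdef]; exact lt_min one_pos (by positivity)
  have hτ1 : ∀ m, τ m ≤ 1 := fun m => by rw [hτdef]; exact min_le_left _ _
  have hτε : ∀ m, 60 * ((2 : ℝ) ^ m) ^ 6 * τ m ≤ ε / 3 := fun m => by
    have h1 : τ m ≤ ε / (180 * ((2 : ℝ) ^ m) ^ 6) := by rw [hτdef]; exact min_le_right _ _
    calc 60 * ((2 : ℝ) ^ m) ^ 6 * τ m
        ≤ 60 * ((2 : ℝ) ^ m) ^ 6 * (ε / (180 * ((2 : ℝ) ^ m) ^ 6)) := by gcongr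
      _ = ε / 3 := by field_simp; norm_num
  choose K hK hscale using fun m => exists_scales (3 * 2 ^ m) (τ m ^ 2) (pow_pos (hτ m) 2)
  obtain ⟨k, hk⟩ := exists_nat_ge (1 / (ε / 9) ^ 2)
  have hk' : 1 ≤ k * (ε / 9) ^ 2 := by rwa [div_le_iff₀ (by positivity)] at hk
  obtain ⟨M, hM⟩ := exists_colouring_of_energy (ε := ε / 9) (by positivity)
    (η := fun m => ε / (36 * K m ^ 2)) (fun m => by have := hK m; positivity) k 0
  have hKM : ∀ m ≤ M, K m ≤ ∑ m ∈ range (M + 1), K m := fun m hm =>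
    single_le_sum (fun i _ => (hK i).le) (mem_range.2 (Nat.lt_succ_of_le hm))
  refine ⟨∑ m ∈ range (M + 1), K m, (hK 0).trans_le (hKM 0 (Nat.zero_le _)), ?_⟩
  intro G _ _ f h0 h1 hmean
  let C₀ : Colouring G 0 := ⟨fun _ => Fin.elim0, fun _ => Fin.elim0, fun _ => Fin.elim0⟩
  have hC₀ : 0 ≤ C₀.energy f := expect_nonneg fun _ _ => sq_nonneg _
  obtain ⟨m, hm, C, f', hf', hL, hcut⟩ := hM G f h0 h1 C₀ (by linarith)
  let u : ((Fin m → Bool) ⊕ ((Fin m → Bool) ⊕ (Fin m → Bool))) → G → ℝ :=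
    Sum.elim (level C.c₁) (Sum.elim (level C.c₂) (level C.c₃))
  have hu : ∀ i x, |u i x| ≤ 1 := by
    rintro (i | i | i) x <;> exact abs_level_le_one _ _ _
  obtain ⟨F₀, F, F₂, hF₀, hF, hF₂, hGF, hgood⟩ := hscale m G _ u (by simp; omega) hu
  have hproj0 : ∀ x y, 0 ≤ C.proj f x y := fun x y => classAvg_nonneg (fun _ => h0 _ _) _
  have hproj1 : ∀ x y, C.proj f x y ≤ 1 := fun x y => classAvg_le_one (fun _ => h1 _ _) _
  have hmain := le_cornerCount_of_fitted (c₁ := C.c₁) (c₂ := C.c₂) (c₃ := C.c₃) hF₀ hF hF₂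
    (hτ m).le (hτ1 m)
    (fun i => ⟨hu (Sum.inl i), hgood (Sum.inl i)⟩)
    (fun i => ⟨hu (Sum.inr (Sum.inl i)), hgood (Sum.inr (Sum.inl i))⟩)
    (fun i => ⟨hu (Sum.inr (Sum.inr i)), hgood (Sum.inr (Sum.inr i))⟩)
    (Φ := fun i j k => classAvg C.joint (fun p => f p.1 p.2) (i, j, k))
    (fun i j k => classAvg_nonneg (fun _ => h0 _ _) _)
    (fun i j k => classAvg_le_one (fun _ => h1 _ _) _) hg hgm hα0 hα1
    ((C.expect_proj f).trans hmean)
  have hmain' : g α ≤ cornerCount F (C.proj f) + 60 * ((2 : ℝ) ^ m) ^ 6 * τ m := by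
    have hcard : (Fintype.card (Fin m → Bool) : ℝ) = 2 ^ m := by simp
    rw [hcard] at hmain
    exact hmain
  have hab : ∀ {t : ℝ}, 0 ≤ t → t ≤ 1 → |t| ≤ 1 := fun ht ht' => by rwa [abs_of_nonneg ht]
  have e1 := abs_cornerCount_sub_le_of_cut F (fun x y => hab (h0 x y) (h1 x y)) hf' hcut
  have e2 := abs_cornerCount_sub_le_expect hF hf' fun x y => hab (hproj0 x y) (hproj1 x y)
  have hF' : (0 : ℝ) < #F := by exact_mod_cast hF.card_pos
  have e3 : 12 * ((Fintype.card G : ℝ) / #F) ^ 2 * (ε / (36 * K m ^ 2)) ≤ ε / 3 := by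
    have hKm := hK m
    have h2 : (Fintype.card G : ℝ) / #F ≤ K m := by rwa [div_le_iff₀ hF']
    calc _ ≤ 12 * K m ^ 2 * (ε / (36 * K m ^ 2)) := by gcongr
      _ = ε / 3 := by field_simp; norm_num
  refine ⟨F, hF, hGF.trans (by gcongr; exact hKM m hm), ?_⟩
  have e4 := (abs_le.1 (e1.trans e3)).1
  have e5 := (abs_le.1 e2).1
  have e6 := hτε m
  linarith

/-- If few pairs in `A` start a corner of any nonzero difference, then `A` has few corners on
average; the difference zero contributes at most `1 / #F`. -/
theorem cornerCount_le_of_forall_card_le {G : Type*} [AddCommGroup G] [Fintype G] [DecidableEq G]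
    {F : Finset G} (hF : F.Nonempty) {A : Finset (G × G)} {f : G → G → ℝ}
    (h0 : ∀ x y, 0 ≤ f x y) (hf : ∀ x y, f x y ≤ if (x, y) ∈ A then 1 else 0) {b : ℝ} (hb : 0 ≤ b)
    (hA : ∀ r ≠ 0, ((cornersWithDifference A r).card : ℝ) ≤ b * (Fintype.card G : ℝ) ^ 2) :
    cornerCount F f ≤ b + 1 / #F := by
  have hne : Nonempty G := ⟨0⟩
  have hG : (0 : ℝ) < Fintype.card G := by exact_mod_cast Fintype.card_pos
  have h1 : ∀ x y, f x y ≤ 1 := fun x y => (hf x y).trans (by split_ifs <;> norm_num)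
  have hr : ∀ r, 𝔼 x, 𝔼 y, f x y * f x (y + r) * f (x + r) y ≤
      ((cornersWithDifference A r).card : ℝ) / (Fintype.card G : ℝ) ^ 2 := by
    intro r
    have e : ((cornersWithDifference A r).card : ℝ) / (Fintype.card G : ℝ) ^ 2 =
        𝔼 x, 𝔼 y, if (x, y) ∈ cornersWithDifference A r then (1 : ℝ) else 0 := by
      rw [← expect_prod_eq fun p => if p ∈ cornersWithDifference A r then (1 : ℝ) else 0,
        Fintype.expect_eq_sum_div_card, Fintype.card_prod]
      simp [sq]
    rw [e]
    refine expect_le_expect fun x _ => expect_le_expect fun y _ => ?_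
    have m1 := hf x y
    have m2 := hf x (y + r)
    have m3 := hf (x + r) y
    split_ifs with hmem
    · exact mul_le_one₀ (mul_le_one₀ (h1 _ _) (h0 _ _) (h1 _ _)) (h0 _ _) (h1 _ _)
    · simp only [cornersWithDifference, mem_filter] at hmem
      by_cases q1 : (x, y) ∈ A
      · by_cases q2 : (x, y + r) ∈ A
        · have q3 : (x + r, y) ∉ A := fun q3 => hmem ⟨q1, q2, q3⟩
          rw [if_neg q3] at m3
          rw [le_antisymm m3 (h0 _ _), mul_zero]
        · rw [if_neg q2] at m2
          rw [le_antisymm m2 (h0 _ _), mul_zero, zero_mul]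
      · rw [if_neg q1] at m1
        rw [le_antisymm m1 (h0 _ _), zero_mul, zero_mul]
  have hst : ∀ s t : G, 𝔼 x, 𝔼 y, f x y * f x (-x - (t - s - x - y)) *
      f (-y - (t - s - x - y)) y ≤ b + if s = t then 1 else 0 := by
    intro s t
    have e : 𝔼 x, 𝔼 y, f x y * f x (-x - (t - s - x - y)) * f (-y - (t - s - x - y)) y =
        𝔼 x, 𝔼 y, f x y * f x (y + (s - t)) * f (x + (s - t)) y := by
      refine expect_congr rfl fun x _ => expect_congr rfl fun y _ => ?_
      rw [show -x - (t - s - x - y) = y + (s - t) by abel,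
        show -y - (t - s - x - y) = x + (s - t) by abel]
    rw [e]
    split_ifs with hst
    -- The difference zero: the only bound is the trivial one.
    · refine le_add_of_nonneg_of_le hb ?_
      exact expect_le_of_forall_le univ_nonempty fun x _ =>
        expect_le_of_forall_le univ_nonempty fun y _ =>
          mul_le_one₀ (mul_le_one₀ (h1 _ _) (h0 _ _) (h1 _ _)) (h0 _ _) (h1 _ _)
    · rw [add_zero]
      refine (hr _).trans ?_
      rw [div_le_iff₀ (by positivity)]
      exact hA _ (sub_ne_zero.2 hst)
  calc cornerCount F f ≤ 𝔼 s ∈ F, 𝔼 t ∈ F, (b + if s = t then 1 else 0) :=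
        expect_le_expect fun s _ => expect_le_expect fun t _ => hst s t
    _ = b + 1 / #F := by
        have e : ∀ s ∈ F, 𝔼 t ∈ F, (b + if s = t then (1 : ℝ) else 0) = b + 1 / #F := by
          intro s hs
          rw [expect_add_distrib, expect_const hF, expect_eq_sum_div_card, sum_ite_eq, if_pos hs]
        rw [expect_congr rfl e, expect_const hF]

/-- The largest convex minorant is approximated at `α` by one convex minorant. -/
theorem exists_convexOn_lt_cornerConvexMinorant (α : ℝ) {ε : ℝ} (hε : 0 < ε) :
    ∃ g : ℝ → ℝ, ConvexOn ℝ (Set.Icc 0 1) g ∧ (∀ β ∈ Set.Icc (0 : ℝ) 1, g β ≤ cornerInf β) ∧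
      cornerConvexMinorant α - ε < g α := by
  have hne : {t : ℝ | ∃ g : ℝ → ℝ, ConvexOn ℝ (Set.Icc 0 1) g ∧
      (∀ β ∈ Set.Icc (0 : ℝ) 1, g β ≤ cornerInf β) ∧ t = g α}.Nonempty := by
    refine ⟨0, fun _ => 0, convexOn_const 0 (convex_Icc 0 1), fun β _ => ?_, rfl⟩
    refine Real.sInf_nonneg ?_
    rintro t ⟨ψ, -, -, rfl⟩
    exact integral_nonneg fun p => mul_nonneg (mul_nonneg (integral_nonneg fun _ => (ψ _).2.1)
      (integral_nonneg fun _ => (ψ _).2.1)) (integral_nonneg fun _ => (ψ _).2.1)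
  obtain ⟨t, ⟨g, hg, hgm, rfl⟩, hlt⟩ := exists_lt_of_lt_csSup hne
    (show cornerConvexMinorant α - ε < cornerConvexMinorant α by linarith)
  exact ⟨g, hg, hgm, hlt⟩

end PopularCorners

open PopularCorners Finset BigOperators in
theorem mainTheorem2 (α : ℝ) (hα0 : 0 ≤ α) (hα1 : α ≤ 1) (ε : ℝ) (hε : 0 < ε) :
    ∃ N : ℕ, ∀ (G : Type*) [AddCommGroup G] [Fintype G] [DecidableEq G],
      N ≤ Fintype.card G →
      ∀ A : Finset (G × G), α * (Fintype.card G : ℝ) ^ 2 ≤ (A.card : ℝ) →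
        ∃ r : G, r ≠ 0 ∧
          (cornerConvexMinorant α - ε) * (Fintype.card G : ℝ) ^ 2 ≤
            ((cornersWithDifference A r).card : ℝ) := by
  obtain ⟨g, hg, hgm, hlt⟩ := exists_convexOn_lt_cornerConvexMinorant α
    (show 0 < ε / 4 by positivity)
  obtain ⟨K, hK, hcount⟩ := exists_le_cornerCount hg hgm hα0 hα1 (show 0 < ε / 4 by positivity)
  obtain ⟨n, hn⟩ := exists_nat_ge (4 * K / ε)
  refine ⟨max 2 n, fun G _ _ _ hN A hA => ?_⟩
  have hG2 : 2 ≤ Fintype.card G := (le_max_left _ _).trans hN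
  have hGn : (n : ℝ) ≤ Fintype.card G := by exact_mod_cast (le_max_right _ _).trans hN
  have hG0 : (0 : ℝ) < Fintype.card G := by
    have : 0 < Fintype.card G := by omega
    exact_mod_cast this
  -- If the claimed number of corners is negative, then every nonzero difference will do.
  rcases lt_or_ge (cornerConvexMinorant α - ε) 0 with hneg | hnonneg
  · have : Nontrivial G := Fintype.one_lt_card_iff_nontrivial.1 (by omega)
    obtain ⟨r, hr⟩ := exists_ne (0 : G)
    exact ⟨r, hr, (mul_nonpos_of_nonpos_of_nonneg hneg.le (by positivity)).trans
      (Nat.cast_nonneg _)⟩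
  by_contra! hcon
  -- A multiple of the indicator function of `A` has mean exactly `α`.
  obtain ⟨t, ht0, ht1, ht⟩ : ∃ t : ℝ, 0 ≤ t ∧ t ≤ 1 ∧
      t * ((A.card : ℝ) / (Fintype.card G : ℝ) ^ 2) = α := by
    have hle : α ≤ (A.card : ℝ) / (Fintype.card G : ℝ) ^ 2 := by
      rwa [le_div_iff₀ (by positivity)]
    rcases hα0.eq_or_lt with rfl | hpos
    · exact ⟨0, le_rfl, zero_le_one, zero_mul _⟩
    · have hpos' := hpos.trans_le hle
      exact ⟨α / ((A.card : ℝ) / (Fintype.card G : ℝ) ^ 2), by positivity,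
        div_le_one_of_le₀ hle hpos'.le, div_mul_cancel₀ _ hpos'.ne'⟩
  let f : G → G → ℝ := fun x y => t * if (x, y) ∈ A then 1 else 0
  have hf0 : ∀ x y, 0 ≤ f x y := fun x y => mul_nonneg ht0 (by split_ifs <;> norm_num)
  have hfA : ∀ x y, f x y ≤ if (x, y) ∈ A then 1 else 0 := fun x y =>
    mul_le_of_le_one_left (by split_ifs <;> norm_num) ht1
  have hmean : 𝔼 x, 𝔼 y, f x y = α := by
    rw [← expect_prod_eq fun p => t * if p ∈ A then (1 : ℝ) else 0, ← mul_expect, ← ht,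
      Fintype.expect_eq_sum_div_card, Fintype.card_prod]
    simp [sq]
  obtain ⟨F, hF, hGF, hle⟩ := hcount G f hf0
    (fun x y => (hfA x y).trans (by split_ifs <;> norm_num)) hmean
  have hupper := cornerCount_le_of_forall_card_le hF hf0 hfA hnonneg fun r hr => (hcon r hr).le
  have hF0 : (0 : ℝ) < #F := by exact_mod_cast hF.card_pos
  have hsmall : 1 / (#F : ℝ) ≤ ε / 4 := by
    rw [div_le_iff₀ hF0]
    have h1 : 4 * K / ε ≤ Fintype.card G := hn.trans hGn
    rw [div_le_iff₀ hε] at h1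
    have h2 : 4 * K ≤ K * #F * ε := h1.trans (by gcongr)
    have h3 : K * 4 ≤ K * (#F * ε) := by linarith
    have h4 := le_of_mul_le_mul_left h3 hK
    linarith
  linarith
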